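/- **Network model.** Transmitters $\{x_k\}_{k\in\mathbb N}$ form a homogeneous Poisson point process of density $\lambda>0$ in $\mathbb R^2$. The receiver $y_k$ of transmitter $k$ has $N_{\rm r}\ge 1$ antennas and is located at $y_k=x_k+v_k$, where the $v_k$ are i.i.d. and uniformly distributed on the annulus $\{1\le\|v\|\le R_{\rm d}\}$, $R_{\rm d}>1$. For all $k,\ell$ the fading vectors ${\bf h}_{k,\ell}\in\mathbb C^{N_{\rm r}}$ (from transmitter $\ell$ to receiver $k$) have i.i.d. $\mathcal{CN}(0,1)$ entries; the process $\{x_k\}$, the vectors $\{v_k\}$ and the fading vectors are independent. Let $d_{k,\ell}=\|y_k-x_\ell\|$, let $\alpha>2$ be the path-loss exponent and $0<{\rm SNR}<\infty$. With maximum ratio combining (MRC) and knowledge of ${\bf h}_{k,k}$ only (direct CSIR), receiver $k$ has $${\rm SINR}_k^{\rm mrc}=\frac{H_{k,k}\,d_{k,k}^{-\alpha}}{\sum_{\ell\ne k}H_{k,\ell}\,d_{k,\ell}^{-\alpha}+\frac1{\rm SNR}},\qquad H_{k,\ell}=\frac{|{\bf h}_{k,k}^*{\bf h}_{k,\ell}|^2}{\|{\bf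 h}_{k,k}\|_2^2}.$$ The sum spectral efficiency per unit area is, for a Borel set $\mathcal A\subset\mathbb R^2$ of area $0<|\mathcal A|<\infty$, $$C_\Sigma^{\rm mrc}=\frac1{|\mathcal A|}\,\mathbb E\Big[\sum_{k:\,x_k\in\mathcal A}\log_2\big(1+{\rm SINR}_k^{\rm mrc}\big)\Big]=\lambda\,\mathbb E^{o}\big[\log_2(1+{\rm SINR}_k^{\rm mrc})\big],$$ where $\mathbb E^o$ is the Palm expectation of the transmitter process, i.e. $\mathbb E^o[f_k]=\frac1{\lambda|\mathcal A|}\mathbb E\big[\sum_{k:\,x_k\in\mathcal A}f_k\big]$ for a quantity $f_k$ seen from the $k$th point. **Theorem.** With ${\rm sinc}(x)=\frac{\sin(\pi x)}{\pi x}$, for every such $\mathcal A$ the sum spectral efficiency is finite, does not depend on $\mathcal A$, and equals $$C_{\Sigma}^{\rm mrc}=\frac{\lambda\,\alpha}{2\ln 2}\int_{1}^{R_{\rm d}}\int_{0}^{\infty}\frac{e^{-\frac{({\rm sinc}(\frac2\alpha)u)^{\alpha/2}}{(\lambda\pi)^{\alpha/2}\,{\rm SNR}}-u}}{u}\;\frac{\sum_{n=1}^{N_{\rm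 r}}\binom{N_{\rm r}}{n}\Big(\frac{{\rm sinc}(\frac2\alpha)\,u}{\lambda\pi r^2}\Big)^{n\frac\alpha2}}{\Big(1+\Big(\frac{{\rm sinc}(\frac2\alpha)\,u}{\lambda\pi r^2}\Big)^{\frac\alpha2}\Big)^{N_{\rm r}}}\,{\rm d}u\;\frac{2r}{R_{\rm d}^2-1}\,{\rm d}r,$$ where both integrals converge absolutely. -/

import Mathlib

open MeasureTheory ProbabilityTheory
open scoped ENNReal NNReal

noncomputable section

/-- The two-dimensional Euclidean plane. -/
abbrev Plane : Type := EuclideanSpace ℝ (Fin 2)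

/-- The number (possibly infinite) of points of the sequence `X` which fall in the set `B`. -/
def pointCount {Ω : Type*} (X : ℕ → Ω → Plane) (B : Set Plane) (ω : Ω) : ℝ≥0∞ :=
  ∑' k, B.indicator (fun _ => (1 : ℝ≥0∞)) (X k ω)

/-- The points `X 0, X 1, …` (in an arbitrary enumeration) form a homogeneous Poisson point process
of density `lam` in the plane: the number of points in a Borel set of finite area is Poisson
with mean `lam * area`, and the numbers of points in disjoint Borel sets are independent. -/
structure IsHomogeneousPPP {Ω : Type*} [MeasurableSpace Ω] (P : Measure Ω)
    (X : ℕ → Ω → Plane) (lam : ℝ) : Prop where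
  measurable : ∀ k, Measurable (X k)
  hasLaw_count : ∀ B : Set Plane, MeasurableSet B → volume B ≠ ∞ →
    HasLaw (pointCount X B)
      ((poissonMeasure (lam.toNNReal * (volume B).toNNReal)).map (Nat.cast : ℕ → ℝ≥0∞)) P
  indep_count : ∀ (n : ℕ) (B : Fin n → Set Plane), (∀ i, MeasurableSet (B i)) →
    Pairwise (fun i j => Disjoint (B i) (B j)) →
    iIndepFun (fun i => pointCount X (B i)) P

/-- The circularly symmetric complex Gaussian law `𝒞𝒩(0, 1)`: real and imaginary part are
independent centred real Gaussians of variance `1 / 2`. -/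
def stdComplexGaussian : Measure ℂ :=
  ((gaussianReal 0 (1 / 2)).prod (gaussianReal 0 (1 / 2))).map
    (fun p : ℝ × ℝ => (⟨p.1, p.2⟩ : ℂ))

/-- The annulus with inner radius `1` and outer radius `R`, centred at the origin. -/
def annulus (R : ℝ) : Set Plane := {x | 1 ≤ ‖x‖ ∧ ‖x‖ ≤ R}

/-- The random objects of a network whose receivers have `N` antennas. -/
structure Network (Ω : Type*) (N : ℕ) where
  /-- the location of transmitter `k` -/
  tx : ℕ → Ω → Plane
  /-- the location of receiver `k` relative to its own transmitter -/
  link : ℕ → Ω → Plane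
  /-- the fading vector from transmitter `l` to receiver `k` -/
  fading : ℕ → ℕ → Ω → EuclideanSpace ℂ (Fin N)

/-- The probabilistic assumptions: the transmitters are a homogeneous Poisson point process of
density `lam`, each receiver is uniform in the annulus of radii `1` and `R` about its
transmitter, all entries of all fading vectors are i.i.d. `𝒞𝒩(0, 1)`, and the transmitters,
the link vectors and the fading are independent. -/
structure Network.IsModel {Ω : Type*} [MeasurableSpace Ω] {N : ℕ} (net : Network Ω N)
    (P : Measure Ω) (lam R : ℝ) : Prop where
  ppp : IsHomogeneousPPP P net.tx lam
  measurable_link : ∀ k, Measurable (net.link k)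
  uniform_link : ∀ k, pdf.IsUniform (net.link k) (annulus R) P volume
  indep_link : iIndepFun net.link P
  measurable_fading : ∀ k l i, Measurable (fun ω => net.fading k l ω i)
  law_fading : ∀ k l i, HasLaw (fun ω => net.fading k l ω i) stdComplexGaussian P
  indep_fading : iIndepFun
    (fun (q : ℕ × ℕ × Fin N) (ω : Ω) => net.fading q.1 q.2.1 ω q.2.2) P
  indep_tx_link : IndepFun (fun ω k => net.tx k ω) (fun ω k => net.link k ω) P
  indep_geometry_fading :
    IndepFun (fun ω => ((fun k => net.tx k ω, fun k => net.link k ω) :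
        (ℕ → Plane) × (ℕ → Plane)))
      (fun ω k l i => net.fading k l ω i) P

namespace Network

variable {Ω : Type*} {N : ℕ} (net : Network Ω N)

/-- The location of receiver `k`. -/
def rx (k : ℕ) (ω : Ω) : Plane := net.tx k ω + net.link k ω

/-- The distance between receiver `k` and transmitter `l`. -/
def dist (k l : ℕ) (ω : Ω) : ℝ := ‖net.rx k ω - net.tx l ω‖

/-- The fading power at receiver `k` of the signal of transmitter `l` after maximum ratio
combining, `|h_{k,k}^* h_{k,l}|² / ‖h_{k,k}‖²`. -/
def gain (k l : ℕ) (ω : Ω) : ℝ :=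
  ‖inner ℂ (net.fading k k ω) (net.fading k l ω)‖ ^ 2 / ‖net.fading k k ω‖ ^ 2

/-- The aggregated interference power at receiver `k`, path-loss exponent `α`. -/
def interference (α : ℝ) (k : ℕ) (ω : Ω) : ℝ≥0∞ :=
  ∑' l, if l = k then 0 else ENNReal.ofReal (net.gain k l ω * net.dist k l ω ^ (-α))

/-- The instantaneous SINR of receiver `k` under maximum ratio combining. -/
def sinr (α SNR : ℝ) (k : ℕ) (ω : Ω) : ℝ≥0∞ :=
  ENNReal.ofReal (net.gain k k ω * net.dist k k ω ^ (-α)) /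
    (net.interference α k ω + ENNReal.ofReal (1 / SNR))

/-- The spectral efficiency `log₂ (1 + SINR)` of link `k`. -/
def rate (α SNR : ℝ) (k : ℕ) (ω : Ω) : ℝ≥0∞ :=
  ENNReal.ofReal (Real.logb 2 (1 + (net.sinr α SNR k ω).toReal))

/-- The sum spectral efficiency per unit area with maximum ratio combining, observed in the
window `A`: the expected sum of the spectral efficiencies of the links with transmitter in `A`
(each suffering from the interference of all other transmitters of the plane), divided by the
area of `A`. -/
def sumSpectralEfficiency [MeasurableSpace Ω] (P : Measure Ω) (α SNR : ℝ) (A : Set Plane) :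
    ℝ≥0∞ :=
  (∫⁻ ω, ∑' k, A.indicator (fun _ => net.rate α SNR k ω) (net.tx k ω) ∂P) / volume A

/-- The Palm expectation of `f` for the transmitter process of density `lam`, computed in the
window `A`, where `f k` is the quantity as seen from the transmitter `k`:
`(lam |A|)⁻¹ 𝔼 ∑_{k : x_k ∈ A} f k`. -/
def palmExpectation [MeasurableSpace Ω] (P : Measure Ω) (lam : ℝ) (A : Set Plane)
    (f : ℕ → Ω → ℝ≥0∞) : ℝ≥0∞ :=
  (∫⁻ ω, ∑' k, A.indicator (fun _ => f k ω) (net.tx k ω) ∂P) /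
    (ENNReal.ofReal lam * volume A)

end Network

/-- The normalized sinc function, `sin (π x) / (π x)` for `x ≠ 0`. -/
def nsinc (x : ℝ) : ℝ := Real.sinc (Real.pi * x)

/-- The inner integrand of the double integral. -/
def mrcIntegrand (lam : ℝ) (N : ℕ) (α SNR r u : ℝ) : ℝ :=
  Real.exp (-((nsinc (2 / α) * u) ^ (α / 2) / ((lam * Real.pi) ^ (α / 2) * SNR)) - u) / u *
    ((∑ n ∈ Finset.Icc 1 N, (N.choose n : ℝ) *
        (nsinc (2 / α) * u / (lam * Real.pi * r ^ 2)) ^ ((n : ℝ) * (α / 2))) /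
      (1 + (nsinc (2 / α) * u / (lam * Real.pi * r ^ 2)) ^ (α / 2)) ^ N)

end

/-!
The proof averages the spectral efficiency over one source of randomness at a time, after a step
that makes everything multiplicative. With signal power `S`, interference power `I` and noise power `σ`,
Frullani's integral
`log (1 + S / (I + σ)) = ∫ t in (0, ∞), t⁻¹ exp (-t σ) (1 - exp (-t S)) exp (-t I) dt`
(`ofReal_log_one_add_div_eq_lintegral`) replaces the logarithm by exponentials, and all later
exchanges of sums and integrals are instances of Tonelli's theorem in `[0, ∞]`.

*Fading.* After maximum ratio combining the signal power is `Gamma (N, 1)` and, conditionally on the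
combining vector, the interfering powers are i.i.d. `Exp (1)`, because a vector of i.i.d. `𝒞𝒩(0, 1)`
variables has a `𝒞𝒩(0, 1)` component in every fixed direction. So the fading average of
`(1 - exp (-t S)) exp (-t I)` factors, for a fixed geometry, into
`1 - (1 + t r ^ (-α)) ^ (-N)`, where `r` is the length of the link, and the product over the interferers of `(1 + t d ^ (-α))⁻¹`
(`Network.IsModel.lintegral_laplaceKernel_fading`).

*Transmitters.* The counts of a Poisson process determine its Laplace functional
(`IsHomogeneousPPP.laplace`). Its derivative in the direction of `1_B e ^ f` is Mecke's formula for
products that do not depend on the removed point (`IsHomogeneousPPP.mecke_const`); approximating the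
removed point by a countable dense set gives the formula for products over the distances to a
receiver attached to the removed point (`IsHomogeneousPPP.mecke_radial`). The sum over the links in `A` thus
contributes `λ |A| exp (-λ ∫ (1 - (1 + t ‖z‖ ^ (-α))⁻¹) dz)`, and the integral over the plane is
`π t ^ (2 / α) / sinc (2 / α)` by polar coordinates and Euler's reflection formula
(`lintegral_plane_one_sub_inv`).

*Links.* The uniform law on the annulus has radial density `2 r / (R ^ 2 - 1)`. The substitution
`u = λ π t ^ (2 / α) / sinc (2 / α)` and the binomial theorem then give the stated integrand.
-/

open Filter Topology

/-! ### The function `exp (-x)` on `[0, ∞]` -/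

/-- The function `x ↦ exp (-x)` on `[0, ∞]`, with `exp (-∞) = 0`. -/
noncomputable def expNeg (x : ℝ≥0∞) : ℝ≥0∞ := EReal.exp (-(x : EReal))

@[simp] lemma expNeg_zero : expNeg 0 = 1 := by simp [expNeg]

@[simp] lemma expNeg_top : expNeg ∞ = 0 := by simp [expNeg]

lemma expNeg_add (x y : ℝ≥0∞) : expNeg (x + y) = expNeg x * expNeg y := by
  unfold expNeg
  rw [← EReal.exp_add, EReal.coe_ennreal_add, EReal.neg_add, sub_eq_add_neg]
  · left; exact EReal.coe_ennreal_ne_bot x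
  · right; exact EReal.coe_ennreal_ne_bot y

lemma expNeg_ofReal {x : ℝ} (hx : 0 ≤ x) :
    expNeg (ENNReal.ofReal x) = ENNReal.ofReal (Real.exp (-x)) := by
  unfold expNeg
  rw [EReal.coe_ennreal_ofReal, max_eq_left hx, ← EReal.coe_neg, EReal.exp_coe]

lemma expNeg_antitone : Antitone expNeg := by
  intro x y h
  exact EReal.exp_monotone (EReal.neg_le_neg_iff.2 (by exact_mod_cast h))

lemma expNeg_le_one (x : ℝ≥0∞) : expNeg x ≤ 1 := by
  simpa using expNeg_antitone (zero_le (a := x))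

lemma expNeg_ne_top (x : ℝ≥0∞) : expNeg x ≠ ∞ :=
  ne_top_of_le_ne_top ENNReal.one_ne_top (expNeg_le_one x)

lemma expNeg_ne_zero {x : ℝ≥0∞} (hx : x ≠ ∞) : expNeg x ≠ 0 := by
  simp [expNeg, hx]

lemma continuous_expNeg : Continuous expNeg :=
  ENNReal.continuous_exp.comp (continuous_neg.comp continuous_coe_ennreal_ereal)

@[fun_prop]
lemma measurable_expNeg : Measurable expNeg := continuous_expNeg.measurable

lemma expNeg_sum {ι : Type*} (s : Finset ι) (f : ι → ℝ≥0∞) :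
    expNeg (∑ i ∈ s, f i) = ∏ i ∈ s, expNeg (f i) := by
  classical
  induction s using Finset.induction_on with
  | empty => simp
  | insert a s ha ih => rw [Finset.sum_insert ha, Finset.prod_insert ha, expNeg_add, ih]

lemma tendsto_expNeg_sum_range (f : ℕ → ℝ≥0∞) :
    Tendsto (fun n => expNeg (∑ i ∈ Finset.range n, f i)) atTop (𝓝 (expNeg (∑' i, f i))) :=
  (continuous_expNeg.tendsto _).comp (ENNReal.tendsto_nat_tsum f)

lemma expNeg_log (x : ℝ≥0∞) : expNeg (ENNReal.log (1 + x)).toENNReal = (1 + x)⁻¹ := by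
  unfold expNeg
  rw [EReal.coe_toENNReal, EReal.exp_neg, ENNReal.exp_log]
  rw [← ENNReal.log_one]
  exact ENNReal.log_monotone (by simp)

/-- `1 - exp (-x) ≤ x`. -/
lemma one_sub_expNeg_le (x : ℝ≥0∞) : 1 - expNeg x ≤ x := by
  rcases eq_or_ne x ∞ with rfl | hx
  · simp
  lift x to ℝ≥0 using hx
  rw [← ENNReal.ofReal_coe_nnreal, expNeg_ofReal x.coe_nonneg, ← ENNReal.ofReal_one,
    ← ENNReal.ofReal_sub _ (Real.exp_pos _).le]
  apply ENNReal.ofReal_le_ofReal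
  linarith [Real.add_one_le_exp (-(x : ℝ))]

/-- `x / (1 + x) ≤ 1 - exp (-x)` for finite `x`. -/
lemma div_one_add_le_one_sub_expNeg {x : ℝ≥0∞} (hx : x ≠ ∞) : x / (1 + x) ≤ 1 - expNeg x := by
  lift x to ℝ≥0 using hx
  have h1 : (0 : ℝ) < 1 + x := by positivity
  rw [← ENNReal.ofReal_coe_nnreal, expNeg_ofReal x.coe_nonneg, ← ENNReal.ofReal_one,
    ← ENNReal.ofReal_sub _ (Real.exp_pos _).le, ← ENNReal.ofReal_add zero_le_one x.coe_nonneg,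
    ← ENNReal.ofReal_div_of_pos h1]
  apply ENNReal.ofReal_le_ofReal
  rw [Real.exp_neg]
  have h2 : (Real.exp x)⁻¹ ≤ (1 + (x : ℝ))⁻¹ :=
    inv_anti₀ h1 (by linarith [Real.add_one_le_exp (x : ℝ)])
  have h3 : (x : ℝ) / (1 + x) = 1 - (1 + (x : ℝ))⁻¹ := by field_simp; ring
  linarith

/-- The difference quotients at `0` of `t ↦ 1 - exp (-t)` along the step sizes `1 / (n + 1)`. -/
lemma tendsto_mul_one_sub_expNeg {y : ℕ → ℝ≥0∞} {c : ℝ≥0∞} (hc : c ≠ ∞)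
    (hy : Tendsto y atTop (𝓝 c)) :
    Tendsto (fun n : ℕ => ((n : ℝ≥0∞) + 1) * (1 - expNeg (y n / ((n : ℝ≥0∞) + 1)))) atTop
      (𝓝 c) := by
  have hN : Tendsto (fun n : ℕ => ((n : ℝ≥0∞) + 1)⁻¹) atTop (𝓝 0) := by
    have := (tendsto_add_atTop_iff_nat 1).2 ENNReal.tendsto_inv_nat_nhds_zero
    simpa using this
  have hn0 : ∀ n : ℕ, ((n : ℝ≥0∞) + 1) ≠ 0 := fun n => by simp
  have hnt : ∀ n : ℕ, ((n : ℝ≥0∞) + 1) ≠ ∞ := fun n => by simp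
  have hlow : Tendsto (fun n : ℕ => y n / (1 + y n / ((n : ℝ≥0∞) + 1))) atTop (𝓝 c) := by
    have h1 : Tendsto (fun n : ℕ => y n / ((n : ℝ≥0∞) + 1)) atTop (𝓝 (c * 0)) := by
      simp_rw [div_eq_mul_inv]
      exact ENNReal.Tendsto.mul hy (Or.inr (by simp)) hN (Or.inr hc)
    have h2 : Tendsto (fun n : ℕ => 1 + y n / ((n : ℝ≥0∞) + 1)) atTop (𝓝 (1 + c * 0)) :=
      tendsto_const_nhds.add h1
    have h3 := ENNReal.Tendsto.div hy (Or.inr (by simp)) h2 (Or.inr hc)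
    simpa using h3
  refine tendsto_of_tendsto_of_tendsto_of_le_of_le' hlow hy ?_ ?_
  · filter_upwards [hy.eventually_ne hc] with n hn
    calc y n / (1 + y n / ((n : ℝ≥0∞) + 1))
        = ((n : ℝ≥0∞) + 1) * (y n / ((n : ℝ≥0∞) + 1) / (1 + y n / ((n : ℝ≥0∞) + 1))) := by
          rw [← mul_div_assoc, ENNReal.mul_div_cancel (hn0 n) (hnt n)]
      _ ≤ _ := by
          gcongr
          exact div_one_add_le_one_sub_expNeg (ENNReal.div_ne_top hn (hn0 n))
  · refine Eventually.of_forall fun n => ?_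
    calc ((n : ℝ≥0∞) + 1) * (1 - expNeg (y n / ((n : ℝ≥0∞) + 1)))
        ≤ ((n : ℝ≥0∞) + 1) * (y n / ((n : ℝ≥0∞) + 1)) := by
          gcongr
          exact one_sub_expNeg_le _
      _ = y n := ENNReal.mul_div_cancel (hn0 n) (hnt n)

lemma mul_one_sub_expNeg_le (n : ℕ) (y : ℝ≥0∞) :
    ((n : ℝ≥0∞) + 1) * (1 - expNeg (y / ((n : ℝ≥0∞) + 1))) ≤ y := by
  calc ((n : ℝ≥0∞) + 1) * (1 - expNeg (y / ((n : ℝ≥0∞) + 1)))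
      ≤ ((n : ℝ≥0∞) + 1) * (y / ((n : ℝ≥0∞) + 1)) := by
        gcongr
        exact one_sub_expNeg_le _
    _ = y := ENNReal.mul_div_cancel (by simp) (by simp)

lemma tendsto_mul_one_sub_expNeg_const (y : ℝ≥0∞) :
    Tendsto (fun n : ℕ => ((n : ℝ≥0∞) + 1) * (1 - expNeg (y / ((n : ℝ≥0∞) + 1)))) atTop
      (𝓝 y) := by
  rcases eq_or_ne y ∞ with rfl | hy
  · have h : ∀ n : ℕ, (∞ : ℝ≥0∞) / ((n : ℝ≥0∞) + 1) = ∞ :=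
      fun n => ENNReal.top_div_of_ne_top (by simp)
    simp only [h, expNeg_top, tsub_zero, mul_one]
    have := (tendsto_add_atTop_iff_nat 1).2 ENNReal.tendsto_nat_nhds_top
    simpa using this
  · exact tendsto_mul_one_sub_expNeg hy tendsto_const_nhds

/-! ### Limits of integrals and sums in `[0, ∞]` -/

/-- Convergence of integrals for a sequence of functions that converges from below, not
necessarily monotonically; no integrability is needed, by Fatou's lemma. -/
lemma tendsto_lintegral_of_le {β : Type*} [MeasurableSpace β] {μ : Measure β}
    {f : ℕ → β → ℝ≥0∞} {g : β → ℝ≥0∞} (hf : ∀ n, AEMeasurable (f n) μ)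
    (hle : ∀ n, ∀ᵐ x ∂μ, f n x ≤ g x)
    (h : ∀ᵐ x ∂μ, Tendsto (fun n => f n x) atTop (𝓝 (g x))) :
    Tendsto (fun n => ∫⁻ x, f n x ∂μ) atTop (𝓝 (∫⁻ x, g x ∂μ)) := by
  refine tendsto_of_le_liminf_of_limsup_le ?_ ?_
  · calc ∫⁻ x, g x ∂μ = ∫⁻ x, liminf (fun n => f n x) atTop ∂μ := by
          refine lintegral_congr_ae ?_
          filter_upwards [h] with x hx using hx.liminf_eq.symm
      _ ≤ _ := lintegral_liminf_le' hf
  · refine limsup_le_of_le (by isBoundedDefault) (Eventually.of_forall fun n => ?_)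
    exact lintegral_mono_ae (hle n)

lemma tendsto_tsum_of_le {f : ℕ → ℕ → ℝ≥0∞} {g : ℕ → ℝ≥0∞} (hle : ∀ n k, f n k ≤ g k)
    (h : ∀ k, Tendsto (fun n => f n k) atTop (𝓝 (g k))) :
    Tendsto (fun n => ∑' k, f n k) atTop (𝓝 (∑' k, g k)) := by
  simp_rw [← lintegral_count]
  exact tendsto_lintegral_of_le (fun n => (measurable_of_countable _).aemeasurable)
    (fun n => ae_of_all _ (hle n)) (ae_of_all _ h)

lemma tendsto_tsum_of_dominated {f : ℕ → ℕ → ℝ≥0∞} {g b : ℕ → ℝ≥0∞} (hle : ∀ n k, f n k ≤ b k)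
    (hb : ∑' k, b k ≠ ∞) (h : ∀ k, Tendsto (fun n => f n k) atTop (𝓝 (g k))) :
    Tendsto (fun n => ∑' k, f n k) atTop (𝓝 (∑' k, g k)) := by
  simp_rw [← lintegral_count]
  rw [← lintegral_count] at hb
  exact tendsto_lintegral_of_dominated_convergence _ (fun n => measurable_of_countable _)
    (fun n => ae_of_all _ (hle n)) hb (ae_of_all _ h)

/-! ### Poisson point processes -/

/-- The Laplace transform of the Poisson law. -/
lemma lintegral_expNeg_mul_poisson (m : ℝ≥0) {c : ℝ≥0∞} (hc : c ≠ ∞) :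
    ∫⁻ x, expNeg (c * x) ∂((poissonMeasure m).map (Nat.cast : ℕ → ℝ≥0∞)) =
      expNeg (m * (1 - expNeg c)) := by
  lift c to ℝ≥0 using hc
  rw [lintegral_map (by fun_prop) (measurable_of_countable _), lintegral_countable']
  have hexp : (1 : ℝ≥0∞) - expNeg c = ENNReal.ofReal (1 - Real.exp (-c)) := by
    rw [← ENNReal.ofReal_coe_nnreal, expNeg_ofReal c.coe_nonneg,
      ENNReal.ofReal_sub _ (Real.exp_pos _).le, ENNReal.ofReal_one]
  have h1 : (0 : ℝ) ≤ 1 - Real.exp (-c) := by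
    have : Real.exp (-(c : ℝ)) ≤ 1 := Real.exp_le_one_iff.2 (by simp)
    linarith
  rw [hexp, ← ENNReal.ofReal_coe_nnreal (p := m), ← ENNReal.ofReal_mul m.coe_nonneg,
    expNeg_ofReal (mul_nonneg m.coe_nonneg h1)]
  have hterm : ∀ n : ℕ, expNeg (c * (n : ℝ≥0∞)) * poissonMeasure m {n} =
      ENNReal.ofReal (Real.exp (-m) * ((m * Real.exp (-c)) ^ n / n.factorial)) := by
    intro n
    rw [poissonMeasure_singleton, ← ENNReal.ofReal_coe_nnreal (p := c), ← ENNReal.ofReal_natCast n,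
      ← ENNReal.ofReal_mul c.coe_nonneg, expNeg_ofReal (by positivity),
      ← ENNReal.ofReal_mul (by positivity)]
    congr 1
    rw [mul_pow, ← Real.exp_nat_mul]
    ring_nf
  simp_rw [hterm]
  have hs : HasSum (fun n : ℕ => Real.exp (-m) * ((m * Real.exp (-c)) ^ n / n.factorial))
      (Real.exp (-m) * Real.exp (m * Real.exp (-c))) := by
    refine HasSum.mul_left _ ?_
    rw [Real.exp_eq_exp_ℝ]
    exact NormedSpace.expSeries_div_hasSum_exp _
  rw [← ENNReal.ofReal_tsum_of_nonneg (fun n => by positivity) hs.summable, hs.tsum_eq,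
    ← Real.exp_add]
  congr 2
  ring

/-- The level sets of a simple function cut off outside `D` are finitely many disjoint subsets of
`D`, simultaneously usable for all functions `h` of its values with `h 0 = 0`. -/
lemma exists_indicator_simpleFunc_eq_sum {E : Type*} [MeasurableSpace E]
    (s : SimpleFunc E ℝ≥0∞) {D : Set E} (hD : MeasurableSet D) :
    ∃ (n : ℕ) (c : Fin n → ℝ≥0∞) (B : Fin n → Set E), (∀ i, c i ∈ s.range) ∧
      (∀ i, MeasurableSet (B i)) ∧ (∀ i, B i ⊆ D) ∧ Pairwise (fun i j => Disjoint (B i) (B j)) ∧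
      ∀ h : ℝ≥0∞ → ℝ≥0∞, h 0 = 0 → ∀ x, h (D.indicator s x) =
        ∑ i, h (c i) * (B i).indicator (fun _ => (1 : ℝ≥0∞)) x := by
  classical
  let e := s.range.equivFin
  refine ⟨s.range.card, fun i => (e.symm i : ℝ≥0∞), fun i => s ⁻¹' {(e.symm i : ℝ≥0∞)} ∩ D,
    fun i => (e.symm i).2, fun i => (s.measurableSet_fiber _).inter hD,
    fun i => Set.inter_subset_right, ?_, ?_⟩
  · intro i j hij
    rw [Set.disjoint_left]
    rintro x ⟨hx, _⟩ ⟨hx', _⟩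
    apply hij
    apply e.symm.injective
    apply Subtype.ext
    rw [Set.mem_preimage, Set.mem_singleton_iff] at hx hx'
    rw [← hx, ← hx']
  · intro h h0 x
    by_cases hx : x ∈ D
    · rw [Finset.sum_eq_single (e ⟨s x, s.mem_range_self x⟩)]
      · simp [hx]
      · intro i _ hi
        rw [Set.indicator_of_notMem, mul_zero]
        rintro ⟨hx', _⟩
        apply hi
        rw [← e.symm_apply_eq.1 ]
        apply Subtype.ext
        simpa using hx'.symm
      · simp
    · rw [Set.indicator_of_notMem hx, h0, Finset.sum_eq_zero]
      intro i _
      rw [Set.indicator_of_notMem (fun h => hx h.2), mul_zero]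

section PPP

variable {Ω : Type*} [MeasurableSpace Ω] {P : Measure Ω} {X : ℕ → Ω → Plane} {lam : ℝ}

lemma IsHomogeneousPPP.measurable_pointCount (h : IsHomogeneousPPP P X lam) {B : Set Plane}
    (hB : MeasurableSet B) : Measurable (pointCount X B) :=
  Measurable.tsum fun k =>
    (measurable_const.indicator hB).comp (h.measurable k)

lemma IsHomogeneousPPP.lintegral_expNeg_mul_pointCount (h : IsHomogeneousPPP P X lam)
    {B : Set Plane} (hB : MeasurableSet B) (hB' : volume B ≠ ∞) {c : ℝ≥0∞} (hc : c ≠ ∞) :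
    ∫⁻ ω, expNeg (c * pointCount X B ω) ∂P =
      expNeg (ENNReal.ofReal lam * ((1 - expNeg c) * volume B)) := by
  rw [(h.hasLaw_count B hB hB').lintegral_comp (f := fun x => expNeg (c * x)) (by fun_prop),
    lintegral_expNeg_mul_poisson _ hc]
  congr 1
  rw [ENNReal.coe_mul, ENNReal.coe_toNNReal hB', mul_assoc, mul_comm (volume B)]
  rfl

lemma IsHomogeneousPPP.laplace_simpleFunc (h : IsHomogeneousPPP P X lam)
    (s : SimpleFunc Plane ℝ≥0∞) (hs : ∀ x, s x ≠ ∞) {D : Set Plane} (hD : MeasurableSet D)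
    (hD' : volume D ≠ ∞) :
    ∫⁻ ω, expNeg (∑' k, D.indicator s (X k ω)) ∂P =
      expNeg (ENNReal.ofReal lam * ∫⁻ x, (1 - expNeg (D.indicator s x))) := by
  obtain ⟨n, c, B, hc, hB, hBD, hdisj, hsum⟩ := exists_indicator_simpleFunc_eq_sum s hD
  have hc' : ∀ i, c i ≠ ∞ := by
    intro i
    obtain ⟨x, hx⟩ := SimpleFunc.mem_range.1 (hc i)
    exact hx ▸ hs x
  have hBv : ∀ i, volume (B i) ≠ ∞ := fun i => measure_ne_top_of_subset (hBD i) hD'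
  have h1 : ∀ ω, expNeg (∑' k, D.indicator s (X k ω)) =
      ∏ i, expNeg (c i * pointCount X (B i) ω) := by
    intro ω
    rw [← expNeg_sum]
    congr 1
    have hid : ∀ x, D.indicator s x = ∑ i, c i * (B i).indicator (fun _ => (1 : ℝ≥0∞)) x :=
      hsum id rfl
    simp_rw [hid]
    rw [Summable.tsum_finsetSum (fun i _ => ENNReal.summable)]
    simp_rw [ENNReal.tsum_mul_left]
    rfl
  simp_rw [h1]
  rw [lintegral_prod_eq_prod_lintegral_of_indepFun Finset.univ
    (fun i ω => expNeg (c i * pointCount X (B i) ω))]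
  · simp_rw [fun i => h.lintegral_expNeg_mul_pointCount (hB i) (hBv i) (hc' i)]
    rw [← expNeg_sum, ← Finset.mul_sum]
    congr 2
    simp_rw [hsum (fun y => 1 - expNeg y) (by simp)]
    rw [lintegral_finsetSum _ fun i _ => (measurable_const.indicator (hB i)).const_mul _]
    refine Finset.sum_congr rfl fun i _ => ?_
    rw [lintegral_const_mul _ (measurable_const.indicator (hB i)), lintegral_indicator (hB i)]
    simp
  · exact (h.indep_count n B hB hdisj).comp (fun i y => expNeg (c i * y)) (fun i => by fun_prop)
  · intro i
    have := h.measurable_pointCount (hB i)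
    fun_prop

/-- The Laplace functional of a homogeneous Poisson point process. -/
theorem IsHomogeneousPPP.laplace (h : IsHomogeneousPPP P X lam) [IsProbabilityMeasure P]
    {f : Plane → ℝ≥0∞} (hf : Measurable f) :
    ∫⁻ ω, expNeg (∑' k, f (X k ω)) ∂P =
      expNeg (ENNReal.ofReal lam * ∫⁻ x, (1 - expNeg (f x))) := by
  let D : ℕ → Set Plane := fun n => Metric.ball 0 n
  let g : ℕ → Plane → ℝ≥0∞ := fun n => (D n).indicator (SimpleFunc.eapprox f n)
  have hD : ∀ n, MeasurableSet (D n) := fun n => measurableSet_ball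
  have hgm : ∀ n, Measurable (g n) := fun n => (SimpleFunc.measurable _).indicator (hD n)
  have hXm := h.measurable
  have hgf : ∀ n x, g n x ≤ f x := by
    intro n x
    refine (Set.indicator_le_self _ _ x).trans ?_
    rw [← SimpleFunc.iSup_eapprox_apply hf x]
    exact le_iSup (fun n => (SimpleFunc.eapprox f n : Plane → ℝ≥0∞) x) n
  have hgt : ∀ x, Tendsto (fun n => g n x) atTop (𝓝 (f x)) := by
    intro x
    refine (SimpleFunc.tendsto_eapprox hf x).congr' ?_
    obtain ⟨m, hm⟩ := exists_nat_gt ‖x‖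
    filter_upwards [eventually_ge_atTop m] with n hn
    have : x ∈ D n := by
      rw [mem_ball_zero_iff]
      exact hm.trans_le (by exact_mod_cast hn)
    simp [g, this]
  have hL : Tendsto (fun n => ∫⁻ ω, expNeg (∑' k, g n (X k ω)) ∂P) atTop
      (𝓝 (∫⁻ ω, expNeg (∑' k, f (X k ω)) ∂P)) := by
    refine tendsto_lintegral_of_dominated_convergence (fun _ => 1) (fun n => ?_) (fun n => ?_)
      (by simp) (ae_of_all _ fun ω => ?_)
    · exact measurable_expNeg.comp (Measurable.tsum fun k => (hgm n).comp (hXm k))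
    · exact ae_of_all _ fun ω => expNeg_le_one _
    · exact (continuous_expNeg.tendsto _).comp
        (tendsto_tsum_of_le (fun n k => hgf n _) fun k => hgt _)
  have hR : Tendsto (fun n => expNeg (ENNReal.ofReal lam * ∫⁻ x, (1 - expNeg (g n x)))) atTop
      (𝓝 (expNeg (ENNReal.ofReal lam * ∫⁻ x, (1 - expNeg (f x))))) := by
    refine (continuous_expNeg.tendsto _).comp ?_
    refine ENNReal.Tendsto.const_mul ?_ (Or.inr ENNReal.ofReal_ne_top)
    refine tendsto_lintegral_of_le (fun n => ?_) (fun n => ae_of_all _ fun x => ?_)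
      (ae_of_all _ fun x => ?_)
    · have := hgm n
      exact (by fun_prop : Measurable fun x => 1 - expNeg (g n x)).aemeasurable
    · exact tsub_le_tsub_left (expNeg_antitone (hgf n x)) 1
    · exact ENNReal.Tendsto.sub tendsto_const_nhds
        ((continuous_expNeg.tendsto _).comp (hgt x)) (Or.inl ENNReal.one_ne_top)
  refine tendsto_nhds_unique hL (hR.congr fun n => ?_)
  refine (h.laplace_simpleFunc (SimpleFunc.eapprox f n)
    (fun x => (SimpleFunc.eapprox_lt_top f n x).ne) (hD n) ?_).symm
  exact measure_ball_lt_top.ne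

/-- Mecke's formula for functionals of product form: the points of the process other than one
located in `B` are again Poisson. It is obtained by differentiating the Laplace functional in the
direction of `1_B e^f`. -/
theorem IsHomogeneousPPP.mecke_const (h : IsHomogeneousPPP P X lam) [IsProbabilityMeasure P]
    {f : Plane → ℝ≥0∞} (hf : Measurable f) (hft : ∀ x, f x ≠ ∞) {B : Set Plane}
    (hB : MeasurableSet B) (hB' : volume B ≠ ∞) :
    ∫⁻ ω, ∑' k, B.indicator (fun _ => 1) (X k ω) *
        expNeg (∑' l, if l = k then 0 else f (X l ω)) ∂P =
      ENNReal.ofReal lam * volume B *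
        expNeg (ENNReal.ofReal lam * ∫⁻ x, (1 - expNeg (f x))) := by
  have hXm := h.measurable
  set Λ : ℝ≥0∞ := ENNReal.ofReal lam
  let g : Plane → ℝ≥0∞ := fun x => B.indicator (fun _ => 1) x * (expNeg (f x))⁻¹
  have hgm : Measurable g := (measurable_const.indicator hB).mul (by fun_prop)
  have hfg : ∀ x, g x * expNeg (f x) = B.indicator (fun _ => 1) x := fun x => by
    rw [mul_assoc, ENNReal.inv_mul_cancel (expNeg_ne_zero (hft x)) (expNeg_ne_top _), mul_one]
  have hΦf : Measurable fun ω => ∑' k, f (X k ω) :=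
    Measurable.tsum fun k => hf.comp (hXm k)
  have hΦg : Measurable fun ω => ∑' k, g (X k ω) :=
    Measurable.tsum fun k => hgm.comp (hXm k)
  have hlhs : ∀ ω, ∑' k, B.indicator (fun _ => 1) (X k ω) *
        expNeg (∑' l, if l = k then 0 else f (X l ω)) =
      expNeg (∑' k, f (X k ω)) * ∑' k, g (X k ω) := by
    intro ω
    rw [← ENNReal.tsum_mul_left]
    refine tsum_congr fun k => ?_
    rw [ENNReal.tsum_eq_add_tsum_ite (f := fun l => f (X l ω)) k, expNeg_add, ← hfg,
      mul_comm (g _), mul_right_comm]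
    congr!
  simp_rw [hlhs]
  -- `D n` is the difference quotient, with step `1 / t n`, of the Laplace functional at `f` in the
  -- direction `-g`; its limit is computed before and after integration
  let t : ℕ → ℝ≥0∞ := fun n => (n : ℝ≥0∞) + 1
  have ht0 : ∀ n, t n ≠ 0 := fun n => by simp [t]
  have htt : ∀ n, t n ≠ ∞ := fun n => by simp [t]
  let D : ℕ → ℝ≥0∞ := fun n => ∫⁻ ω, expNeg (∑' k, f (X k ω)) *
    (t n * (1 - expNeg ((∑' k, g (X k ω)) / t n))) ∂P
  have hD1 : Tendsto D atTop (𝓝 (∫⁻ ω, expNeg (∑' k, f (X k ω)) * ∑' k, g (X k ω) ∂P)) := by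
    refine tendsto_lintegral_of_le (fun n => ?_) (fun n => ae_of_all _ fun ω => ?_)
      (ae_of_all _ fun ω => ?_)
    · exact (by fun_prop : Measurable _).aemeasurable
    · exact mul_le_mul_right (mul_one_sub_expNeg_le n _) _
    · exact ENNReal.Tendsto.const_mul (tendsto_mul_one_sub_expNeg_const _)
        (Or.inr (expNeg_ne_top _))
  let b : ℕ → ℝ≥0∞ := fun n => Λ * ∫⁻ x, expNeg (f x) * (1 - expNeg (g x / t n))
  have hDb : ∀ n, D n = expNeg (Λ * ∫⁻ x, (1 - expNeg (f x))) *
      (t n * (1 - expNeg (b n))) := by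
    intro n
    have hsum : ∀ ω, (∑' k, f (X k ω)) + (∑' k, g (X k ω)) / t n =
        ∑' k, (f (X k ω) + g (X k ω) / t n) := fun ω => by
      simp_rw [div_eq_mul_inv]
      rw [ENNReal.tsum_add, ENNReal.tsum_mul_right]
    have h2 := h.laplace (f := fun x => f x + g x / t n) (by fun_prop)
    have h3 : ∫⁻ x, (1 - expNeg (f x + g x / t n)) =
        (∫⁻ x, (1 - expNeg (f x))) + ∫⁻ x, expNeg (f x) * (1 - expNeg (g x / t n)) := by
      rw [← lintegral_add_left (by fun_prop)]
      refine lintegral_congr fun x => ?_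
      rw [ENNReal.mul_sub (fun _ _ => expNeg_ne_top _), mul_one, expNeg_add,
        tsub_add_tsub_cancel (expNeg_le_one _)]
      exact mul_le_of_le_one_right' (expNeg_le_one _)
    rw [h3, mul_add, expNeg_add] at h2
    have h4 : ∀ ω, expNeg (∑' k, f (X k ω)) *
        (t n * (1 - expNeg ((∑' k, g (X k ω)) / t n))) =
        t n * (expNeg (∑' k, f (X k ω)) - expNeg (∑' k, (f (X k ω) + g (X k ω) / t n))) := by
      intro ω
      rw [← hsum, expNeg_add, mul_left_comm, ENNReal.mul_sub (fun _ _ => expNeg_ne_top _), mul_one]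
    calc D n = ∫⁻ ω, t n * (expNeg (∑' k, f (X k ω)) -
            expNeg (∑' k, (f (X k ω) + g (X k ω) / t n))) ∂P := lintegral_congr h4
      _ = t n * (∫⁻ ω, expNeg (∑' k, f (X k ω)) ∂P -
            ∫⁻ ω, expNeg (∑' k, (f (X k ω) + g (X k ω) / t n)) ∂P) := by
          have hm2 : Measurable fun ω => ∑' k, (f (X k ω) + g (X k ω) / t n) := by
            simp_rw [← hsum]; fun_prop
          rw [lintegral_const_mul _ (by fun_prop), lintegral_sub (by fun_prop)]
          · rw [h2]
            exact ENNReal.mul_ne_top (expNeg_ne_top _) (expNeg_ne_top _)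
          · refine ae_of_all _ fun ω => ?_
            simp only [← hsum]
            exact expNeg_antitone le_self_add
      _ = _ := by
          rw [h2, h.laplace hf, mul_left_comm (expNeg _),
            ENNReal.mul_sub (fun _ _ => expNeg_ne_top _), mul_one]
  have hb : Tendsto (fun n => t n * b n) atTop (𝓝 (Λ * volume B)) := by
    have h1 : ∀ n, t n * b n = Λ * ∫⁻ x, expNeg (f x) * (t n * (1 - expNeg (g x / t n))) := by
      intro n
      simp only [b]
      rw [mul_left_comm, ← lintegral_const_mul _ (by fun_prop)]
      simp_rw [mul_left_comm (t n)]
    simp_rw [h1]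
    refine ENNReal.Tendsto.const_mul ?_ (Or.inr ENNReal.ofReal_ne_top)
    have h2 : volume B = ∫⁻ x, expNeg (f x) * g x := by
      simp_rw [mul_comm (expNeg _), hfg]
      rw [lintegral_indicator hB]
      simp
    rw [h2]
    refine tendsto_lintegral_of_le (fun n => ?_) (fun n => ae_of_all _ fun ω => ?_)
      (ae_of_all _ fun ω => ?_)
    · exact (by fun_prop : Measurable _).aemeasurable
    · exact mul_le_mul_right (mul_one_sub_expNeg_le n _) _
    · exact ENNReal.Tendsto.const_mul (tendsto_mul_one_sub_expNeg_const _)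
        (Or.inr (expNeg_ne_top _))
  have hD2 : Tendsto D atTop
      (𝓝 (expNeg (Λ * ∫⁻ x, (1 - expNeg (f x))) * (Λ * volume B))) := by
    simp_rw [funext hDb]
    refine ENNReal.Tendsto.const_mul ?_ (Or.inr (expNeg_ne_top _))
    have := tendsto_mul_one_sub_expNeg (ENNReal.mul_ne_top ENNReal.ofReal_ne_top hB') hb
    refine this.congr fun n => ?_
    have h5 : t n * b n / ((n : ℝ≥0∞) + 1) = b n := by
      rw [mul_comm]
      exact ENNReal.mul_div_cancel_right (ht0 n) (htt n)
    rw [h5]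
  rw [tendsto_nhds_unique hD1 hD2, mul_comm]

end PPP

section PPP

variable {Ω : Type*} [MeasurableSpace Ω] {P : Measure Ω} {X : ℕ → Ω → Plane} {lam : ℝ}

/-- Mecke's formula for product functionals that depend on the location of the removed point only
through countably many values. -/
lemma IsHomogeneousPPP.mecke_countable (h : IsHomogeneousPPP P X lam) [IsProbabilityMeasure P]
    {ι : Plane → ℕ} (hι : Measurable ι) {f : ℕ → Plane → ℝ≥0∞} (hf : ∀ j, Measurable (f j))
    (hft : ∀ j x, f j x ≠ ∞) {I : ℝ≥0∞} (hI : ∀ j, ∫⁻ x, (1 - expNeg (f j x)) = I)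
    {A : Set Plane} (hA : MeasurableSet A) (hA' : volume A ≠ ∞) :
    ∫⁻ ω, ∑' k, A.indicator (fun _ => 1) (X k ω) *
        expNeg (∑' l, if l = k then 0 else f (ι (X k ω)) (X l ω)) ∂P =
      ENNReal.ofReal lam * volume A * expNeg (ENNReal.ofReal lam * I) := by
  classical
  have hXm := h.measurable
  have hB : ∀ j, MeasurableSet (A ∩ ι ⁻¹' {j}) := fun j =>
    hA.inter (hι (measurableSet_singleton j))
  have h1 : ∀ ω, ∑' k, A.indicator (fun _ => 1) (X k ω) *
        expNeg (∑' l, if l = k then 0 else f (ι (X k ω)) (X l ω)) =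
      ∑' j, ∑' k, (A ∩ ι ⁻¹' {j}).indicator (fun _ => 1) (X k ω) *
        expNeg (∑' l, if l = k then 0 else f j (X l ω)) := by
    intro ω
    rw [ENNReal.tsum_comm]
    refine tsum_congr fun k => ?_
    refine ((tsum_eq_single (ι (X k ω)) fun j hj => ?_).trans ?_).symm
    · rw [Set.indicator_of_notMem, zero_mul]
      exact fun hx => hj hx.2.symm
    · congr 1
      by_cases hk : X k ω ∈ A <;> simp [hk]
  simp_rw [h1]
  rw [lintegral_tsum]
  · have h2 := fun j => h.mecke_const (hf j) (hft j) (hB j)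
      (measure_ne_top_of_subset Set.inter_subset_left hA')
    simp_rw [h2, hI]
    rw [ENNReal.tsum_mul_right, ENNReal.tsum_mul_left]
    congr 2
    rw [← measure_iUnion _ hB]
    · rw [← Set.inter_iUnion]
      congr 1
      ext x
      simp
    · intro i j hij
      refine Set.disjoint_left.2 fun x hx hx' => hij ?_
      exact hx.2.symm.trans hx'.2
  · intro j
    refine (Measurable.tsum fun k => ?_).aemeasurable
    refine ((measurable_const.indicator (hB j)).comp (hXm k)).mul (measurable_expNeg.comp ?_)
    refine Measurable.tsum fun l => ?_
    split_ifs
    · exact measurable_const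
    · exact (hf j).comp (hXm l)

/-- Passage to the limit in Mecke's formula. The approximations `f n` only need to lie below `g`:
this handles infinite sums over `l`, while finiteness of the intensity handles the sum over `k`. -/
lemma tendsto_lintegral_tsum_indicator_expNeg (hX : ∀ k, Measurable (X k)) {A : Set Plane}
    (hA : MeasurableSet A) (hint : ∫⁻ ω, ∑' k, A.indicator (fun _ => (1 : ℝ≥0∞)) (X k ω) ∂P ≠ ∞)
    {f : ℕ → Plane → Plane → ℝ≥0∞} (hf : ∀ n, Measurable fun q : Plane × Plane => f n q.1 q.2)
    {g : Plane → Plane → ℝ≥0∞} (hle : ∀ n x y, f n x y ≤ g x y)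
    (htend : ∀ x y, Tendsto (fun n => f n x y) atTop (𝓝 (g x y))) :
    Tendsto (fun n => ∫⁻ ω, ∑' k, A.indicator (fun _ => 1) (X k ω) *
        expNeg (∑' l, if l = k then 0 else f n (X k ω) (X l ω)) ∂P) atTop
      (𝓝 (∫⁻ ω, ∑' k, A.indicator (fun _ => 1) (X k ω) *
        expNeg (∑' l, if l = k then 0 else g (X k ω) (X l ω)) ∂P)) := by
  have hindm : ∀ k, Measurable fun ω => A.indicator (fun _ => (1 : ℝ≥0∞)) (X k ω) := fun k =>
    (measurable_const.indicator hA).comp (hX k)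
  refine tendsto_lintegral_of_dominated_convergence
    (fun ω => ∑' k, A.indicator (fun _ => (1 : ℝ≥0∞)) (X k ω)) (fun n => ?_) (fun n => ?_)
    hint ?_
  · refine Measurable.tsum fun k => (hindm k).mul (measurable_expNeg.comp ?_)
    refine Measurable.tsum fun l => ?_
    split_ifs
    · exact measurable_const
    · exact (hf n).comp ((hX k).prodMk (hX l))
  · refine ae_of_all _ fun ω => ENNReal.tsum_le_tsum fun k => ?_
    exact mul_le_of_le_one_right' (expNeg_le_one _)
  · filter_upwards [ae_lt_top (Measurable.tsum hindm) hint] with ω hω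
    refine tendsto_tsum_of_dominated (fun n k => mul_le_of_le_one_right' (expNeg_le_one _)) hω.ne
      fun k => ?_
    refine ENNReal.Tendsto.const_mul ((continuous_expNeg.tendsto _).comp ?_)
      (Or.inr (by by_cases hk : X k ω ∈ A <;> simp [hk]))
    refine tendsto_tsum_of_le (fun n l => ?_) (fun l => ?_)
    · split_ifs
      · exact le_rfl
      · exact hle _ _ _
    · split_ifs
      · exact tendsto_const_nhds
      · exact htend _ _

/-- Mecke's formula for a product over the distances between the other points and a point
displaced by `v` from the removed one; `F` may be infinite at `0`. -/
theorem IsHomogeneousPPP.mecke_radial (h : IsHomogeneousPPP P X lam) [IsProbabilityMeasure P]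
    {F : ℝ → ℝ≥0∞} (hFa : Antitone F) (hFc : Continuous F) (hF : ∀ t, 0 < t → F t ≠ ∞)
    (v : Plane) {A : Set Plane} (hA : MeasurableSet A) (hA' : volume A ≠ ∞) :
    ∫⁻ ω, ∑' k, A.indicator (fun _ => 1) (X k ω) *
        expNeg (∑' l, if l = k then 0 else F ‖X k ω + v - X l ω‖) ∂P =
      ENNReal.ofReal lam * volume A *
        expNeg (ENNReal.ofReal lam * ∫⁻ z : Plane, (1 - expNeg (F ‖z‖))) := by
  classical
  have hXm := h.measurable
  have hFm := hFc.measurable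
  obtain ⟨ε, hε, hε0⟩ : ∃ ε : ℕ → ℝ, (∀ n, 0 < ε n) ∧ Tendsto ε atTop (𝓝 0) :=
    ⟨fun n => 1 / ((n : ℝ) + 1), fun n => by positivity, tendsto_one_div_add_atTop_nhds_zero_nat⟩
  let p := TopologicalSpace.denseSeq Plane
  obtain ⟨ι, hι, hιd⟩ : ∃ ι : ℕ → Plane → ℕ, (∀ n, Measurable (ι n)) ∧
      ∀ n x, ‖x - p (ι n x)‖ < ε n := by
    have hp : ∀ n x, ∃ j, dist x (p j) < ε n := fun n x =>
      (TopologicalSpace.denseRange_denseSeq Plane).exists_dist_lt x (hε n)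
    refine ⟨fun n x => Nat.find (hp n x), fun n =>
      measurable_find (hp n) fun k => measurableSet_lt (by fun_prop) measurable_const,
      fun n x => ?_⟩
    rw [← dist_eq_norm]
    exact Nat.find_spec (hp n x)
  -- enlarging the distance by `ε n` makes the exponent finite and a lower bound for the true one
  let f : ℕ → ℕ → Plane → ℝ≥0∞ := fun n j y => F (‖p j + v - y‖ + ε n)
  have hfm : ∀ n j, Measurable (f n j) := fun n j => by fun_prop
  have hI : ∀ n j, ∫⁻ y, (1 - expNeg (f n j y)) =
      ∫⁻ z : Plane, (1 - expNeg (F (‖z‖ + ε n))) := fun n j =>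
    lintegral_sub_left_eq_self (fun z : Plane => 1 - expNeg (F (‖z‖ + ε n))) (p j + v)
  have hmecke := fun n => h.mecke_countable (hι n) (hfm n)
    (fun j x => hF _ (by have := hε n; positivity)) (hI n) hA hA'
  -- the intensity of the process is Mecke's formula with `f = 0`
  have hint : ∫⁻ ω, ∑' k, A.indicator (fun _ => (1 : ℝ≥0∞)) (X k ω) ∂P ≠ ∞ := by
    have h1 := h.mecke_const (f := fun _ => 0) measurable_const (by simp) hA hA'
    simp only [ite_self, tsum_zero, expNeg_zero, mul_one, tsub_self, lintegral_const, zero_mul,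
      mul_zero] at h1
    rw [h1]
    exact ENNReal.mul_ne_top ENNReal.ofReal_ne_top hA'
  have hle : ∀ n x y, f n (ι n x) y ≤ F ‖x + v - y‖ := by
    intro n x y
    refine hFa ?_
    calc ‖x + v - y‖ = ‖(p (ι n x) + v - y) + (x - p (ι n x))‖ := by congr 1; abel
      _ ≤ ‖p (ι n x) + v - y‖ + ‖x - p (ι n x)‖ := norm_add_le _ _
      _ ≤ _ := by gcongr; exact (hιd n x).le
  have htend : ∀ x y, Tendsto (fun n => f n (ι n x) y) atTop (𝓝 (F ‖x + v - y‖)) := by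
    intro x y
    refine (hFc.tendsto _).comp ?_
    have hpx : Tendsto (fun n => p (ι n x)) atTop (𝓝 x) := by
      rw [tendsto_iff_norm_sub_tendsto_zero]
      refine squeeze_zero (fun n => norm_nonneg _) (fun n => ?_) hε0
      rw [norm_sub_rev]
      exact (hιd n x).le
    simpa using ((hpx.add_const v).sub_const y).norm.add hε0
  have hL : Tendsto (fun n => ∫⁻ ω, ∑' k, A.indicator (fun _ => 1) (X k ω) *
        expNeg (∑' l, if l = k then 0 else f n (ι n (X k ω)) (X l ω)) ∂P) atTop
      (𝓝 (∫⁻ ω, ∑' k, A.indicator (fun _ => 1) (X k ω) *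
        expNeg (∑' l, if l = k then 0 else F ‖X k ω + v - X l ω‖) ∂P)) := by
    refine tendsto_lintegral_tsum_indicator_expNeg hXm hA hint
      (f := fun n x y => f n (ι n x) y) (fun n => ?_) hle htend
    have hpm : Measurable fun x => p (ι n x) := measurable_from_nat.comp (hι n)
    change Measurable fun q : Plane × Plane => F (‖p (ι n q.1) + v - q.2‖ + ε n)
    fun_prop
  have hR : Tendsto (fun n => ENNReal.ofReal lam * volume A *
        expNeg (ENNReal.ofReal lam * ∫⁻ z : Plane, (1 - expNeg (F (‖z‖ + ε n))))) atTop
      (𝓝 (ENNReal.ofReal lam * volume A *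
        expNeg (ENNReal.ofReal lam * ∫⁻ z : Plane, (1 - expNeg (F ‖z‖))))) := by
    refine ENNReal.Tendsto.const_mul ((continuous_expNeg.tendsto _).comp ?_)
      (Or.inr (ENNReal.mul_ne_top ENNReal.ofReal_ne_top hA'))
    refine ENNReal.Tendsto.const_mul ?_ (Or.inr ENNReal.ofReal_ne_top)
    refine tendsto_lintegral_of_le (fun n => ?_) (fun n => ae_of_all _ fun x => ?_)
      (ae_of_all _ fun x => ?_)
    · exact (by fun_prop : Measurable fun z : Plane => 1 - expNeg (F (‖z‖ + ε n))).aemeasurable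
    · exact tsub_le_tsub_left (expNeg_antitone (hFa (by linarith [hε n]))) 1
    · refine ENNReal.Tendsto.sub tendsto_const_nhds
        ((continuous_expNeg.tendsto _).comp ((hFc.tendsto _).comp ?_)) (Or.inl ENNReal.one_ne_top)
      simpa using tendsto_const_nhds.add hε0
  exact tendsto_nhds_unique hL (hR.congr fun n => (hmecke n).symm)

end PPP

/-! ### Integrals -/

/-- A nonzero value of the Bochner integral certifies integrability. -/
lemma lintegral_ofReal_of_integral_eq {s : Set ℝ} (hs : MeasurableSet s) {f : ℝ → ℝ} {c : ℝ}
    (hf : ∀ x ∈ s, 0 ≤ f x) (hc : c ≠ 0) (h : ∫ x in s, f x = c) :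
    ∫⁻ x in s, ENNReal.ofReal (f x) = ENNReal.ofReal c := by
  rw [← h, ofReal_integral_eq_lintegral_ofReal]
  · by_contra hi
    rw [integral_undef hi] at h
    exact hc h.symm
  · exact (ae_restrict_iff' hs).2 (ae_of_all _ hf)

/-- Integration of radial functions over the plane in polar coordinates. -/
lemma lintegral_fun_norm_plane {f : ℝ → ℝ≥0∞} (hf : Measurable f) :
    ∫⁻ z : Plane, f ‖z‖ = ∫⁻ r in Set.Ioi 0, ENNReal.ofReal (2 * Real.pi * r) * f r := by
  have hdim : Module.finrank ℝ Plane = 2 := by simp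
  have hball : (volume : Measure Plane).toSphere Set.univ = ENNReal.ofReal (2 * Real.pi) := by
    rw [Measure.toSphere_apply_univ, EuclideanSpace.volume_ball_fin_two, hdim]
    rw [ENNReal.ofReal_mul zero_le_two]
    simp
  calc ∫⁻ z : Plane, f ‖z‖ = ∫⁻ x : ({(0)}ᶜ : Set Plane), f ‖x.1‖ 
          ∂((volume : Measure Plane).comap Subtype.val) := by
        rw [lintegral_subtype_comap (measurableSet_singleton _).compl fun x => f ‖x‖,
          restrict_compl_singleton]
    _ = ∫⁻ x, f x.2 ∂(volume : Measure Plane).toSphere.prod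
          (.volumeIoiPow (Module.finrank ℝ Plane - 1)) := by
        simpa using
          (volume : Measure Plane).measurePreserving_homeomorphUnitSphereProd.lintegral_comp_emb
          (Homeomorph.measurableEmbedding _) (f ∘ Subtype.val ∘ Prod.snd)
    _ = ENNReal.ofReal (2 * Real.pi) * ∫⁻ x : Set.Ioi (0 : ℝ), f x ∂.volumeIoiPow 1 := by
        rw [lintegral_prod _ (by fun_prop), hdim]
        simp only [lintegral_const, hball]
        rw [mul_comm]
    _ = _ := by
        rw [Measure.volumeIoiPow, lintegral_withDensity_eq_lintegral_mul _ (by fun_prop)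
          (by fun_prop)]
        simp only [Pi.mul_apply, pow_one]
        rw [lintegral_subtype_comap measurableSet_Ioi fun r : ℝ => ENNReal.ofReal r * f r,
          ← lintegral_const_mul _ (by fun_prop)]
        refine setLIntegral_congr_fun measurableSet_Ioi fun r _ => ?_
        rw [← mul_assoc, ← ENNReal.ofReal_mul (by positivity)]

/-- Polar coordinates on the annulus of radii `1` and `R`. -/
lemma lintegral_annulus {R : ℝ} {f : ℝ → ℝ≥0∞} (hf : Measurable f) :
    ∫⁻ v in annulus R, f ‖v‖ =
      ∫⁻ r in Set.Ioc 1 R, ENNReal.ofReal (2 * Real.pi * r) * f r := by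
  have hset : annulus R = norm ⁻¹' Set.Icc 1 R := rfl
  have hm : MeasurableSet (annulus R) := hset ▸ measurable_norm measurableSet_Icc
  rw [← lintegral_indicator hm]
  have h1 : ∀ v : Plane, (annulus R).indicator (fun v => f ‖v‖) v = (Set.Icc 1 R).indicator f ‖v‖ :=
    fun v => rfl
  simp_rw [h1]
  rw [lintegral_fun_norm_plane (hf.indicator measurableSet_Icc), restrict_Ioc_eq_restrict_Icc,
    ← lintegral_indicator measurableSet_Ioi, ← lintegral_indicator measurableSet_Icc]
  refine lintegral_congr fun r => ?_
  by_cases hr : r ∈ Set.Icc 1 R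
  · have hr0 : r ∈ Set.Ioi (0 : ℝ) := Set.mem_Ioi.2 (by linarith [hr.1])
    simp only [Set.indicator_of_mem hr, Set.indicator_of_mem hr0]
  · by_cases hr0 : r ∈ Set.Ioi (0 : ℝ) <;> simp [hr, Set.indicator]

lemma lintegral_exp_neg_mul_Ioi {c : ℝ} (hc : 0 < c) :
    ∫⁻ t in Set.Ioi 0, ENNReal.ofReal (Real.exp (-(t * c))) = ENNReal.ofReal (1 / c) := by
  refine lintegral_ofReal_of_integral_eq measurableSet_Ioi (fun x _ => by positivity)
    (by positivity) ?_
  have := integral_exp_mul_Ioi (a := -c) (by linarith) 0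
  simp only [mul_zero, Real.exp_zero, neg_div_neg_eq] at this
  rw [← this]
  simp [mul_comm]

lemma nsinc_pos {α : ℝ} (hα : 2 < α) : 0 < nsinc (2 / α) := by
  have h1 : 0 < 2 / α := by positivity
  have h2 : 2 / α < 1 := (div_lt_one (by linarith)).2 hα
  have h3 : 0 < Real.pi * (2 / α) := by positivity
  unfold nsinc
  rw [Real.sinc_of_ne_zero h3.ne']
  refine div_pos (Real.sin_pos_of_pos_of_lt_pi h3 ?_) h3
  nlinarith [Real.pi_pos]

/-- The exponent of the Laplace functional of the interference of a Poisson field of transmitters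
with exponentially distributed fading powers. -/
lemma lintegral_plane_one_sub_inv {α : ℝ} (hα : 2 < α) {s : ℝ} (hs : 0 < s) :
    ∫⁻ z : Plane, (1 - (1 + ENNReal.ofReal s * ENNReal.ofReal ‖z‖ ^ (-α))⁻¹) =
      ENNReal.ofReal (Real.pi * s ^ (2 / α) / nsinc (2 / α)) := by
  have hα0 : 0 < α := by linarith
  have h21 : 2 / α < 1 := (div_lt_one (by linarith)).2 hα
  rw [lintegral_fun_norm_plane
    (f := fun r => 1 - (1 + ENNReal.ofReal s * ENNReal.ofReal r ^ (-α))⁻¹) (by fun_prop)]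
  -- `1 - (1 + s r ^ (-α))⁻¹ = (1 + r ^ α / s)⁻¹ = ∫ exp (-x (1 + r ^ α / s)) dx`, which reduces the
  -- integral to two Gamma integrals, first in `r` and then in `x`
  have h1 : ∀ r ∈ Set.Ioi (0 : ℝ), ENNReal.ofReal (2 * Real.pi * r) *
      (1 - (1 + ENNReal.ofReal s * ENNReal.ofReal r ^ (-α))⁻¹) =
      ∫⁻ x in Set.Ioi 0, ENNReal.ofReal (2 * Real.pi) * (ENNReal.ofReal (Real.exp (-x)) *
        ENNReal.ofReal (r * Real.exp (-(x / s) * r ^ α))) := by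
    intro r (hr : 0 < r)
    have hrα : 0 < r ^ α := Real.rpow_pos_of_pos hr _
    have hrα' : 0 < r ^ (-α) := Real.rpow_pos_of_pos hr _
    have e1 : ∀ x : ℝ, ENNReal.ofReal (2 * Real.pi) * (ENNReal.ofReal (Real.exp (-x)) *
        ENNReal.ofReal (r * Real.exp (-(x / s) * r ^ α))) = ENNReal.ofReal (2 * Real.pi * r) *
          ENNReal.ofReal (Real.exp (-(x * (1 + r ^ α / s)))) := by
      intro x
      rw [← ENNReal.ofReal_mul (by positivity), ← ENNReal.ofReal_mul (by positivity),
        ← ENNReal.ofReal_mul (by positivity)]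
      congr 1
      rw [mul_left_comm (Real.exp _), ← Real.exp_add]
      ring_nf
    simp_rw [e1]
    rw [lintegral_const_mul _ (by fun_prop), lintegral_exp_neg_mul_Ioi (by positivity)]
    congr 1
    rw [ENNReal.ofReal_rpow_of_pos hr, ← ENNReal.ofReal_mul hs.le, ← ENNReal.ofReal_one,
      ← ENNReal.ofReal_add zero_le_one (by positivity), ← ENNReal.ofReal_inv_of_pos (by positivity),
      ← ENNReal.ofReal_sub _ (by positivity)]
    congr 1
    rw [Real.rpow_neg hr.le]
    field_simp
    ring
  rw [setLIntegral_congr_fun measurableSet_Ioi h1, lintegral_lintegral_swap (by fun_prop)]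
  have h2 : ∀ x ∈ Set.Ioi (0 : ℝ), ∫⁻ r in Set.Ioi 0, ENNReal.ofReal (2 * Real.pi) *
      (ENNReal.ofReal (Real.exp (-x)) * ENNReal.ofReal (r * Real.exp (-(x / s) * r ^ α))) =
      ENNReal.ofReal (2 * Real.pi * s ^ (2 / α) * (1 / α) * Real.Gamma (2 / α)) *
        ENNReal.ofReal (Real.exp (-x) * x ^ (1 - 2 / α - 1)) := by
    intro x (hx : 0 < x)
    have hG : 0 < Real.Gamma (2 / α) := Real.Gamma_pos_of_pos (by positivity)
    rw [lintegral_const_mul _ (by fun_prop), lintegral_const_mul _ (by fun_prop)]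
    have e1 : ∫⁻ r in Set.Ioi 0, ENNReal.ofReal (r * Real.exp (-(x / s) * r ^ α)) =
        ENNReal.ofReal ((x / s) ^ (-(1 + 1) / α) * (1 / α) * Real.Gamma ((1 + 1) / α)) := by
      refine lintegral_ofReal_of_integral_eq measurableSet_Ioi
        (fun r (hr : 0 < r) => by positivity) ?_ ?_
      · have : 0 < Real.Gamma ((1 + 1) / α) := Real.Gamma_pos_of_pos (by positivity)
        positivity
      · rw [← integral_rpow_mul_exp_neg_mul_rpow hα0 (by norm_num) (by positivity)]
        simp
    rw [e1, ← ENNReal.ofReal_mul (by positivity), ← ENNReal.ofReal_mul (by positivity),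
      ← ENNReal.ofReal_mul (by positivity)]
    congr 1
    rw [Real.div_rpow hx.le hs.le, show (-(1 + 1) / α) = -(2 / α) by ring,
      show ((1 : ℝ) + 1) / α = 2 / α by ring, Real.rpow_neg hs.le,
      show (1 - 2 / α - 1) = -(2 / α) by ring]
    field_simp
  rw [setLIntegral_congr_fun measurableSet_Ioi h2, lintegral_const_mul _ (by fun_prop)]
  have hG1 : 0 < Real.Gamma (1 - 2 / α) := Real.Gamma_pos_of_pos (by linarith)
  have hG : 0 < Real.Gamma (2 / α) := Real.Gamma_pos_of_pos (by positivity)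
  rw [lintegral_ofReal_of_integral_eq measurableSet_Ioi (c := Real.Gamma (1 - 2 / α))
    (fun x (hx : 0 < x) => by positivity) hG1.ne'
    (Real.Gamma_eq_integral (by linarith)).symm, ← ENNReal.ofReal_mul (by positivity)]
  congr 1
  rw [mul_assoc, Real.Gamma_mul_Gamma_one_sub]
  have h3 : 0 < Real.pi * (2 / α) := by positivity
  have hsin : 0 < Real.sin (Real.pi * (2 / α)) :=
    Real.sin_pos_of_pos_of_lt_pi h3 (by nlinarith [Real.pi_pos])
  unfold nsinc
  rw [Real.sinc_of_ne_zero h3.ne']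
  field_simp

/-- A Frullani-type integral for `log (1 + S / (I + σ))`, in which the signal power `S` and the
interference power `I` enter only through their exponentials. -/
lemma ofReal_log_one_add_div_eq_lintegral (I : ℝ≥0∞) {S σ : ℝ} (hS : 0 ≤ S) (hσ : 0 < σ) :
    ENNReal.ofReal (Real.log (1 + (ENNReal.ofReal S / (I + ENNReal.ofReal σ)).toReal)) =
      ∫⁻ t in Set.Ioi 0, (ENNReal.ofReal t)⁻¹ * (expNeg (ENNReal.ofReal t * ENNReal.ofReal σ) *
        ((1 - expNeg (ENNReal.ofReal t * ENNReal.ofReal S)) * expNeg (ENNReal.ofReal t * I))) := by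
  rcases eq_or_ne I ∞ with rfl | hI
  · have h0 : ∀ t ∈ Set.Ioi (0 : ℝ), (ENNReal.ofReal t)⁻¹ *
        (expNeg (ENNReal.ofReal t * ENNReal.ofReal σ) *
        ((1 - expNeg (ENNReal.ofReal t * ENNReal.ofReal S)) * expNeg (ENNReal.ofReal t * ∞))) =
        0 := by
      intro t (ht : 0 < t)
      rw [ENNReal.mul_top (by simpa using ht), expNeg_top]
      simp
    rw [setLIntegral_congr_fun measurableSet_Ioi h0]
    simp
  lift I to ℝ≥0 using hI
  set b : ℝ := I + σ with hb
  have hb0 : 0 < b := by positivity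
  have hsum : (I : ℝ≥0∞) + ENNReal.ofReal σ = ENNReal.ofReal b := by
    rw [hb, ENNReal.ofReal_add I.coe_nonneg hσ.le, ENNReal.ofReal_coe_nnreal]
  -- `(1 - exp (-t S)) / t` is the integral of `exp (-t y)` over `0 < y ≤ S`
  have h1 : ∀ t ∈ Set.Ioi (0 : ℝ), (ENNReal.ofReal t)⁻¹ *
        (expNeg (ENNReal.ofReal t * ENNReal.ofReal σ) *
        ((1 - expNeg (ENNReal.ofReal t * ENNReal.ofReal S)) * expNeg (ENNReal.ofReal t * I))) =
      ∫⁻ y in Set.Ioc 0 S, ENNReal.ofReal (Real.exp (-(t * (b + y)))) := by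
    intro t (ht : 0 < t)
    have e1 : ∫ y in (0 : ℝ)..S, Real.exp (-(t * (b + y))) =
        Real.exp (-(t * b)) * ((1 - Real.exp (-(t * S))) / t) := by
      have hd : ∀ y ∈ Set.uIcc 0 S, HasDerivAt (fun y => -(Real.exp (-(t * (b + y))) / t))
          (Real.exp (-(t * (b + y)))) y := by
        intro y _
        have := ((((hasDerivAt_id y).const_add b).const_mul t).neg.exp.div_const t).neg
        convert! this using 1
        simp
        field_simp
      rw [intervalIntegral.integral_eq_sub_of_hasDerivAt hd
        (Continuous.intervalIntegrable (by fun_prop) _ _)]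
      rw [show -(t * (b + S)) = -(t * b) + -(t * S) by ring, Real.exp_add]
      simp
      field_simp
      ring
    rw [intervalIntegral.integral_of_le hS] at e1
    rw [← ofReal_integral_eq_lintegral_ofReal
      ((by fun_prop : Continuous fun y => Real.exp (-(t * (b + y)))).integrableOn_Ioc)
      (ae_of_all _ fun y => (Real.exp_pos _).le), e1, ← mul_assoc, mul_left_comm, ← mul_assoc,
      ← mul_assoc, mul_right_comm, mul_assoc, mul_assoc, ← expNeg_add, ← mul_add,
      hsum,
      ← ENNReal.ofReal_mul ht.le, ← ENNReal.ofReal_mul ht.le, expNeg_ofReal (by positivity),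
      expNeg_ofReal (by positivity), ← ENNReal.ofReal_one,
      ← ENNReal.ofReal_sub _ (Real.exp_pos _).le, ← ENNReal.ofReal_inv_of_pos ht]
    have h0 : Real.exp (-(t * S)) ≤ 1 := Real.exp_le_one_iff.2 (by
      have : 0 ≤ t * S := by positivity
      linarith)
    rw [← ENNReal.ofReal_mul (inv_nonneg.2 ht.le), ← ENNReal.ofReal_mul (by linarith)]
    congr 1
    field_simp
  rw [setLIntegral_congr_fun measurableSet_Ioi h1, lintegral_lintegral_swap (by fun_prop)]
  have h2 : ∀ y ∈ Set.Ioc (0 : ℝ) S, ∫⁻ t in Set.Ioi 0, ENNReal.ofReal (Real.exp (-(t * (b + y)))) =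
      ENNReal.ofReal (1 / (b + y)) := fun y hy => lintegral_exp_neg_mul_Ioi (by linarith [hy.1])
  rw [setLIntegral_congr_fun measurableSet_Ioc h2, hsum, ← ENNReal.ofReal_div_of_pos hb0,
    ENNReal.toReal_ofReal (by positivity)]
  have hcont : ContinuousOn (fun y => 1 / (b + y)) (Set.Icc 0 S) := by
    refine continuousOn_const.div (by fun_prop) fun y hy => ?_
    linarith [hy.1]
  rw [← ofReal_integral_eq_lintegral_ofReal
    ((hcont.integrableOn_Icc).mono_set Set.Ioc_subset_Icc_self)
    ((ae_restrict_iff' measurableSet_Ioc).2 (ae_of_all _ fun y hy => by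
      have := hy.1
      positivity)), ← intervalIntegral.integral_of_le hS]
  congr 1
  have := intervalIntegral.integral_comp_add_left (fun y => 1 / y) b (a := 0) (b := S)
  rw [this, integral_one_div_of_pos (by linarith) (by linarith)]
  congr 1
  field_simp
  ring

/-! ### Rayleigh fading -/

lemma measurable_complex_mk : Measurable (fun p : ℝ × ℝ => (⟨p.1, p.2⟩ : ℂ)) :=
  Complex.measurableEquivRealProd.symm.measurable

instance : IsProbabilityMeasure stdComplexGaussian :=
  Measure.isProbabilityMeasure_map measurable_complex_mk.aemeasurable

lemma charFun_stdComplexGaussian (t : ℂ) :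
    charFun stdComplexGaussian t = Complex.exp (-(‖t‖ ^ 2 / 4 : ℝ)) := by
  have h1 : charFun stdComplexGaussian t =
      charFun (gaussianReal 0 (1 / 2)) t.re * charFun (gaussianReal 0 (1 / 2)) t.im := by
    rw [charFun_apply, stdComplexGaussian, integral_map measurable_complex_mk.aemeasurable
      (by fun_prop), charFun_apply, charFun_apply, ← integral_prod_mul]
    refine integral_congr_ae (ae_of_all _ fun p => ?_)
    simp only [Complex.inner, Complex.mul_re, Complex.conj_re, Complex.conj_im]
    rw [← Complex.exp_add, ← add_mul]
    congr 2
    simp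
  rw [h1, charFun_gaussianReal, charFun_gaussianReal, ← Complex.exp_add]
  congr 1
  rw [← Complex.normSq_eq_norm_sq, Complex.normSq_apply]
  push_cast
  ring

lemma charFun_map_const_mul_stdComplexGaussian (c t : ℂ) :
    charFun (stdComplexGaussian.map (c * ·)) t = Complex.exp (-(‖c‖ ^ 2 * (‖t‖ ^ 2 / 4) : ℝ)) := by
  have h : charFun (stdComplexGaussian.map (c * ·)) t =
      charFun stdComplexGaussian (starRingEnd ℂ c * t) := by
    rw [charFun_apply, integral_map (by fun_prop) (by fun_prop), charFun_apply]
    refine integral_congr_ae (ae_of_all _ fun z => ?_)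
    simp only [Complex.inner, map_mul]
    ring_nf
  rw [h, charFun_stdComplexGaussian]
  congr 3
  rw [norm_mul, RCLike.norm_conj]
  ring

/-- The unitary invariance of a vector of i.i.d. `𝒞𝒩(0, 1)` variables: its component in the
direction of a unit vector is again `𝒞𝒩(0, 1)`. -/
lemma map_sum_mul_eq_stdComplexGaussian {Ω : Type*} [MeasurableSpace Ω] {P : Measure Ω} {N : ℕ}
    {h : Fin N → Ω → ℂ} (hm : ∀ i, Measurable (h i))
    (hl : ∀ i, HasLaw (h i) stdComplexGaussian P) (hi : iIndepFun h P) {c : Fin N → ℂ}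
    (hc : ∑ i, ‖c i‖ ^ 2 = 1) :
    P.map (fun ω => ∑ i, c i * h i ω) = stdComplexGaussian := by
  have := hi.isProbabilityMeasure
  have hcm : ∀ i, Measurable fun ω => c i * h i ω := fun i => (hm i).const_mul _
  have : IsProbabilityMeasure (P.map (fun ω => ∑ i, c i * h i ω)) :=
    Measure.isProbabilityMeasure_map (by fun_prop)
  refine Measure.ext_of_charFun ?_
  have hi' : iIndepFun (fun i ω => c i * h i ω) P :=
    hi.comp (fun i z => c i * z) (fun i => by fun_prop)
  rw [hi'.charFun_map_fun_sum_eq_prod (fun i => (hcm i).aemeasurable)]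
  ext t
  have hmap : ∀ i, P.map (fun ω => c i * h i ω) = stdComplexGaussian.map (c i * ·) := by
    intro i
    rw [← (hl i).map_eq, Measure.map_map (by fun_prop) (hm i)]
    rfl
  simp_rw [Finset.prod_apply, hmap, charFun_map_const_mul_stdComplexGaussian]
  rw [charFun_stdComplexGaussian, ← Complex.exp_sum]
  congr 1
  rw [Finset.sum_neg_distrib, ← Complex.ofReal_sum, ← Finset.sum_mul, hc, one_mul]

lemma lintegral_exp_neg_sq_gaussianReal {s : ℝ} (hs : 0 ≤ s) :
    ∫⁻ x, ENNReal.ofReal (Real.exp (-(s * x ^ 2))) ∂gaussianReal 0 (1 / 2) =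
      ENNReal.ofReal (√(1 + s))⁻¹ := by
  have hint : Integrable (fun x => Real.exp (-(s * x ^ 2))) (gaussianReal 0 (1 / 2)) := by
    refine Integrable.of_bound (by fun_prop) 1 (ae_of_all _ fun x => ?_)
    rw [Real.norm_of_nonneg (Real.exp_pos _).le]
    exact Real.exp_le_one_iff.2 (by have : 0 ≤ s * x ^ 2 := by positivity
                                    linarith)
  rw [← ofReal_integral_eq_lintegral_ofReal hint (ae_of_all _ fun x => (Real.exp_pos _).le),
    integral_gaussianReal_eq_integral_smul (by norm_num)]
  congr 1
  have h1 : ∀ x : ℝ, gaussianPDFReal 0 (1 / 2) x • Real.exp (-(s * x ^ 2)) =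
      (√Real.pi)⁻¹ * Real.exp (-(1 + s) * x ^ 2) := by
    intro x
    have hpi : 2 * Real.pi * ((1 / 2 : ℝ≥0) : ℝ) = Real.pi := by push_cast; ring
    rw [gaussianPDFReal, smul_eq_mul, mul_assoc, ← Real.exp_add, hpi]
    congr 2
    push_cast
    ring
  simp_rw [h1]
  rw [integral_const_mul, integral_gaussian, Real.sqrt_div Real.pi_pos.le]
  have : √Real.pi ≠ 0 := (Real.sqrt_pos.2 Real.pi_pos).ne'
  field_simp

/-- The squared modulus of a `𝒞𝒩(0, 1)` variable is exponentially distributed. -/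
lemma lintegral_expNeg_normSq_stdComplexGaussian {s : ℝ} (hs : 0 ≤ s) :
    ∫⁻ z, expNeg (ENNReal.ofReal (s * ‖z‖ ^ 2)) ∂stdComplexGaussian =
      (1 + ENNReal.ofReal s)⁻¹ := by
  rw [stdComplexGaussian, lintegral_map (by fun_prop) measurable_complex_mk]
  have h1 : ∀ p : ℝ × ℝ, expNeg (ENNReal.ofReal (s * ‖(⟨p.1, p.2⟩ : ℂ)‖ ^ 2)) =
      ENNReal.ofReal (Real.exp (-(s * p.1 ^ 2))) * ENNReal.ofReal (Real.exp (-(s * p.2 ^ 2))) := by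
    intro p
    rw [expNeg_ofReal (by positivity), ← ENNReal.ofReal_mul (by positivity), ← Real.exp_add,
      ← Complex.normSq_eq_norm_sq, Complex.normSq_mk]
    ring_nf
  simp_rw [h1]
  rw [lintegral_prod_mul (f := fun x : ℝ => ENNReal.ofReal (Real.exp (-(s * x ^ 2))))
    (g := fun x : ℝ => ENNReal.ofReal (Real.exp (-(s * x ^ 2)))) (by fun_prop) (by fun_prop),
    lintegral_exp_neg_sq_gaussianReal hs,
    ← ENNReal.ofReal_mul (by positivity), ← mul_inv, Real.mul_self_sqrt (by linarith),
    ENNReal.ofReal_inv_of_pos (by linarith), ENNReal.ofReal_add zero_le_one hs, ENNReal.ofReal_one]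

/-- Fubini's theorem for a function of two independent random variables: the second one is
replaced by a copy on a second sample point. -/
lemma ProbabilityTheory.IndepFun.lintegral_comp_prodMk {Ω β γ : Type*} [MeasurableSpace Ω]
    [MeasurableSpace β] [MeasurableSpace γ] {P : Measure Ω} [IsProbabilityMeasure P]
    {R : Ω → β} {Y : Ω → γ}
    (h : IndepFun R Y P) (hR : Measurable R) (hY : Measurable Y) {f : β → γ → ℝ≥0∞}
    (hf : Measurable fun p : β × γ => f p.1 p.2) :
    ∫⁻ ω, f (R ω) (Y ω) ∂P = ∫⁻ ω, ∫⁻ ω', f (R ω) (Y ω') ∂P ∂P := by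
  have := Measure.isProbabilityMeasure_map (μ := P) hY.aemeasurable
  have h1 : ∫⁻ ω, f (R ω) (Y ω) ∂P = ∫⁻ p, f p.1 p.2 ∂(P.map fun ω => (R ω, Y ω)) := by
    rw [lintegral_map hf (hR.prodMk hY)]
  rw [h1, (indepFun_iff_map_prod_eq_prod_map_map hR.aemeasurable hY.aemeasurable).1 h,
    lintegral_prod _ hf.aemeasurable, lintegral_map hf.lintegral_prod_right' hR]
  refine lintegral_congr fun ω => ?_
  exact lintegral_map (f := fun b => f (R ω) b) (hf.comp measurable_prodMk_left) hY

section Fading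

variable {Ω : Type*} [MeasurableSpace Ω] {P : Measure Ω} {N : ℕ}

/-- The power received in a fixed nonzero direction `a` is exponentially distributed. -/
lemma lintegral_expNeg_mul_norm_inner_sq {a : EuclideanSpace ℂ (Fin N)} (ha : a ≠ 0)
    {h : Ω → EuclideanSpace ℂ (Fin N)} (hm : ∀ i, Measurable fun ω => h ω i)
    (hl : ∀ i, HasLaw (fun ω => h ω i) stdComplexGaussian P)
    (hi : iIndepFun (fun i ω => h ω i) P) {s : ℝ} (hs : 0 ≤ s) :
    ∫⁻ ω, expNeg (ENNReal.ofReal (s * (‖inner ℂ a (h ω)‖ ^ 2 / ‖a‖ ^ 2))) ∂P =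
      (1 + ENNReal.ofReal s)⁻¹ := by
  have ha' : 0 < ‖a‖ := norm_pos_iff.2 ha
  let c : Fin N → ℂ := fun i => starRingEnd ℂ (a i) / ‖a‖
  have hc : ∑ i, ‖c i‖ ^ 2 = 1 := by
    have : ∀ i, ‖c i‖ ^ 2 = ‖a i‖ ^ 2 / ‖a‖ ^ 2 := fun i => by
      simp [c, div_pow]
    simp_rw [this]
    rw [← Finset.sum_div, ← EuclideanSpace.norm_sq_eq, div_self (by positivity)]
  have h1 : ∀ ω, s * (‖inner ℂ a (h ω)‖ ^ 2 / ‖a‖ ^ 2) = s * ‖∑ i, c i * h ω i‖ ^ 2 := by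
    intro ω
    have : ∑ i, c i * h ω i = inner ℂ a (h ω) / ‖a‖ := by
      rw [PiLp.inner_apply, Finset.sum_div]
      refine Finset.sum_congr rfl fun i _ => ?_
      simp only [c, RCLike.inner_apply]
      ring
    rw [this, norm_div, div_pow]
    simp
  have hsm : Measurable fun ω => ∑ i, c i * h ω i :=
    Finset.measurable_fun_sum _ fun i _ => (hm i).const_mul _
  simp_rw [h1]
  rw [← lintegral_expNeg_normSq_stdComplexGaussian hs,
    ← map_sum_mul_eq_stdComplexGaussian hm hl hi hc, lintegral_map (by fun_prop) hsm]

lemma measurable_norm_inner_sq_div : Measurable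
    fun p : EuclideanSpace ℂ (Fin N) × EuclideanSpace ℂ (Fin N) =>
      ‖inner ℂ p.1 p.2‖ ^ 2 / ‖p.1‖ ^ 2 :=
  (continuous_inner.norm.pow 2).measurable.div ((continuous_fst.norm.pow 2).measurable)

lemma measurable_expNeg_mul_gain (w : ℝ) : Measurable
    fun p : EuclideanSpace ℂ (Fin N) × EuclideanSpace ℂ (Fin N) =>
      expNeg (ENNReal.ofReal (w * (‖inner ℂ p.1 p.2‖ ^ 2 / ‖p.1‖ ^ 2))) :=
  measurable_expNeg.comp (measurable_norm_inner_sq_div.const_mul w).ennreal_ofReal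

lemma measurable_euclideanSpace_of_apply {h : Ω → EuclideanSpace ℂ (Fin N)}
    (hm : ∀ i, Measurable fun ω => h ω i) : Measurable h :=
  (WithLp.measurable_toLp 2 (Fin N → ℂ)).comp (measurable_pi_lambda _ hm)

/-- Independence of all entries of a family of random vectors yields independence of one vector
and finitely many others. -/
lemma indepFun_ite_of_iIndepFun {H : ℕ → Ω → EuclideanSpace ℂ (Fin N)}
    (hm : ∀ l i, Measurable fun ω => H l ω i)
    (hi : iIndepFun (fun (q : ℕ × Fin N) ω => H q.1 ω q.2) P) {S : Finset ℕ} {m : ℕ}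
    (hmS : m ∉ S) :
    IndepFun (fun ω l => if l ∈ S then H l ω else 0) (H m) P := by
  classical
  have hdisj : Disjoint (S ×ˢ (Finset.univ : Finset (Fin N)))
      ({m} ×ˢ (Finset.univ : Finset (Fin N))) := by
    rw [Finset.disjoint_left]
    rintro ⟨l, i⟩ h1 h2
    simp only [Finset.mem_product, Finset.mem_univ, and_true, Finset.mem_singleton] at h1 h2
    exact hmS (h2 ▸ h1)
  have h := hi.indepFun_finset _ _ hdisj (fun q => hm q.1 q.2)
  let φ : (↥(S ×ˢ (Finset.univ : Finset (Fin N))) → ℂ) → ℕ → EuclideanSpace ℂ (Fin N) :=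
    fun x l => if hl : l ∈ S then WithLp.toLp 2 fun i => x ⟨(l, i), by simp [hl]⟩ else 0
  let ψ : (↥(({m} : Finset ℕ) ×ˢ (Finset.univ : Finset (Fin N))) → ℂ) → EuclideanSpace ℂ (Fin N) :=
    fun x => WithLp.toLp 2 fun i => x ⟨(m, i), by simp⟩
  have hφ : Measurable φ := by
    refine measurable_pi_lambda _ fun l => ?_
    by_cases hl : l ∈ S
    · simp only [φ, hl, dif_pos]
      exact (WithLp.measurable_toLp 2 (Fin N → ℂ)).comp
        (measurable_pi_lambda _ fun i => measurable_pi_apply _)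
    · simp only [φ, hl, dif_neg, not_false_iff]
      exact measurable_const
  have hψ : Measurable ψ := (WithLp.measurable_toLp 2 (Fin N → ℂ)).comp
    (measurable_pi_lambda _ fun i => measurable_pi_apply _)
  have h2 := h.comp hφ hψ
  convert! h2 using 1

/-- If each interfering vector contributes a factor whose conditional expectation given the vector
used for combining does not depend on the latter, the factors behave as if all were independent. -/
lemma lintegral_mul_prod_of_iIndepFun [IsProbabilityMeasure P]
    {H : ℕ → Ω → EuclideanSpace ℂ (Fin N)} (hm : ∀ l i, Measurable fun ω => H l ω i)
    (hi : iIndepFun (fun (q : ℕ × Fin N) ω => H q.1 ω q.2) P) {k : ℕ}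
    {ψ : EuclideanSpace ℂ (Fin N) → ℝ≥0∞} (hψ : Measurable ψ)
    {q : ℕ → EuclideanSpace ℂ (Fin N) → EuclideanSpace ℂ (Fin N) → ℝ≥0∞}
    (hq : ∀ l, Measurable fun p : EuclideanSpace ℂ (Fin N) × EuclideanSpace ℂ (Fin N) =>
        q l p.1 p.2) {c : ℕ → ℝ≥0∞} (hc : ∀ l, c l ≠ ∞)
    (hqc : ∀ l, ∀ᵐ ω ∂P, ∫⁻ ω', q l (H k ω) (H l ω') ∂P = c l) (T : Finset ℕ) (hkT : k ∉ T) :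
    ∫⁻ ω, ψ (H k ω) * ∏ l ∈ T, q l (H k ω) (H l ω) ∂P = (∫⁻ ω, ψ (H k ω) ∂P) * ∏ l ∈ T, c l := by
  classical
  have hH : ∀ l, Measurable (H l) := fun l => measurable_euclideanSpace_of_apply (hm l)
  induction T using Finset.induction_on with
  | empty => simp
  | insert m T hmT ih =>
    have hkT' : k ∉ T := fun h => hkT (Finset.mem_insert_of_mem h)
    have hmk : m ≠ k := fun h => hkT (h ▸ Finset.mem_insert_self _ _)
    let S := insert k T
    have hmS : m ∉ S := by simp [S, hmk, hmT]
    -- all vectors treated so far, as one random variable independent of `H m`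
    let R : Ω → ℕ → EuclideanSpace ℂ (Fin N) := fun ω l => if l ∈ S then H l ω else 0
    have hRm : Measurable R := measurable_pi_lambda _ fun l => by
      by_cases hlS : l ∈ S
      · simpa [R, hlS] using hH l
      · simp [R, hlS]
    have hind : IndepFun R (H m) P := indepFun_ite_of_iIndepFun hm hi hmS
    let f : (ℕ → EuclideanSpace ℂ (Fin N)) → EuclideanSpace ℂ (Fin N) → ℝ≥0∞ := fun r b =>
      (ψ (r k) * ∏ l ∈ T, q l (r k) (r l)) * q m (r k) b
    have hf : Measurable fun p : (ℕ → EuclideanSpace ℂ (Fin N)) × EuclideanSpace ℂ (Fin N) =>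
        f p.1 p.2 := by
      refine Measurable.mul (Measurable.mul ?_ (Finset.measurable_fun_prod _ fun l _ => ?_)) ?_
      · exact hψ.comp ((measurable_pi_apply k).comp measurable_fst)
      · have h1 : Measurable fun p : (ℕ → EuclideanSpace ℂ (Fin N)) × EuclideanSpace ℂ (Fin N) =>
            (p.1 k, p.1 l) := by fun_prop
        exact (hq l).comp h1
      · have h1 : Measurable fun p : (ℕ → EuclideanSpace ℂ (Fin N)) × EuclideanSpace ℂ (Fin N) =>
            (p.1 k, p.2) := by fun_prop
        exact (hq m).comp h1
    have hRk : ∀ ω, R ω k = H k ω := fun ω => by simp [R, S]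
    have hRT : ∀ ω, ∀ l ∈ T, R ω l = H l ω := fun ω l hlT => by simp [R, S, hlT]
    have hfR : ∀ ω b, f (R ω) b =
        (ψ (H k ω) * ∏ l ∈ T, q l (H k ω) (H l ω)) * q m (H k ω) b := by
      intro ω b
      simp only [f, hRk]
      congr 2
      exact Finset.prod_congr rfl fun l hlT => by rw [hRT ω l hlT]
    have hinner : ∀ᵐ ω ∂P, ∫⁻ ω', f (R ω) (H m ω') ∂P =
        (ψ (H k ω) * ∏ l ∈ T, q l (H k ω) (H l ω)) * c m := by
      filter_upwards [hqc m] with ω hω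
      simp_rw [hfR]
      have h1 : Measurable fun ω' => q m (H k ω) (H m ω') :=
        (hq m).comp (measurable_const.prodMk (hH m))
      rw [lintegral_const_mul _ h1, hω]
    calc ∫⁻ ω, ψ (H k ω) * ∏ l ∈ insert m T, q l (H k ω) (H l ω) ∂P
        = ∫⁻ ω, f (R ω) (H m ω) ∂P := by
          refine lintegral_congr fun ω => ?_
          rw [hfR, Finset.prod_insert hmT]
          ring
      _ = ∫⁻ ω, (ψ (H k ω) * ∏ l ∈ T, q l (H k ω) (H l ω)) * c m ∂P := by
          rw [hind.lintegral_comp_prodMk hRm (hH m) hf]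
          exact lintegral_congr_ae hinner
      _ = _ := by
          rw [lintegral_mul_const' _ _ (hc m), ih hkT', Finset.prod_insert hmT]
          ring

/-- Conditionally on the vector used for combining, the interfering powers after maximum ratio
combining are i.i.d. exponential; hence they are independent of that vector. -/
lemma lintegral_mul_expNeg_tsum_gain [IsProbabilityMeasure P]
    {H : ℕ → Ω → EuclideanSpace ℂ (Fin N)}
    (hm : ∀ l i, Measurable fun ω => H l ω i)
    (hl : ∀ l i, HasLaw (fun ω => H l ω i) stdComplexGaussian P)
    (hi : iIndepFun (fun (q : ℕ × Fin N) ω => H q.1 ω q.2) P) {k : ℕ}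
    (h0 : ∀ᵐ ω ∂P, H k ω ≠ 0) {ψ : EuclideanSpace ℂ (Fin N) → ℝ≥0∞} (hψ : Measurable ψ)
    (hψ1 : ∀ a, ψ a ≤ 1) {w : ℕ → ℝ} (hw : ∀ l, 0 ≤ w l) :
    ∫⁻ ω, ψ (H k ω) * expNeg (∑' l, if l = k then 0 else
        ENNReal.ofReal (w l * (‖inner ℂ (H k ω) (H l ω)‖ ^ 2 / ‖H k ω‖ ^ 2))) ∂P =
      (∫⁻ ω, ψ (H k ω) ∂P) *
        expNeg (∑' l, if l = k then 0 else (ENNReal.log (1 + ENNReal.ofReal (w l))).toENNReal) := by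
  classical
  have hH : ∀ l, Measurable (H l) := fun l => measurable_euclideanSpace_of_apply (hm l)
  have hprod : ∀ (n : ℕ) (g : ℕ → ℝ≥0∞),
      expNeg (∑ l ∈ Finset.range n, if l = k then 0 else g l) =
        ∏ l ∈ (Finset.range n).erase k, expNeg (g l) := by
    intro n g
    rw [← expNeg_sum]
    congr 1
    rw [← Finset.sum_filter_of_ne (p := fun l => l ≠ k) (fun l _ h hlk => h (by simp [hlk])),
      Finset.filter_ne']
    exact Finset.sum_congr rfl fun l hlm => by rw [if_neg (Finset.ne_of_mem_erase hlm)]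
  have hfin : ∀ n : ℕ, ∫⁻ ω, ψ (H k ω) * expNeg (∑ l ∈ Finset.range n, if l = k then 0 else
        ENNReal.ofReal (w l * (‖inner ℂ (H k ω) (H l ω)‖ ^ 2 / ‖H k ω‖ ^ 2))) ∂P =
      (∫⁻ ω, ψ (H k ω) ∂P) * expNeg (∑ l ∈ Finset.range n, if l = k then 0 else
        (ENNReal.log (1 + ENNReal.ofReal (w l))).toENNReal) := by
    intro n
    simp_rw [hprod, expNeg_log]
    refine lintegral_mul_prod_of_iIndepFun hm hi hψ
      (q := fun l a b => expNeg (ENNReal.ofReal (w l * (‖inner ℂ a b‖ ^ 2 / ‖a‖ ^ 2))))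
      (fun l => measurable_expNeg_mul_gain (w l)) (fun l => by simp) (fun l => ?_) _
      (Finset.notMem_erase _ _)
    filter_upwards [h0] with ω hω
    refine lintegral_expNeg_mul_norm_inner_sq hω (hm l) (hl l) ?_ (hw l)
    exact hi.precomp (g := fun i : Fin N => (l, i)) fun i j hij => (Prod.mk.inj hij).2
  have hgm : ∀ l, Measurable fun ω => (if l = k then 0 else
      ENNReal.ofReal (w l * (‖inner ℂ (H k ω) (H l ω)‖ ^ 2 / ‖H k ω‖ ^ 2)) : ℝ≥0∞) := by
    intro l
    split_ifs
    · exact measurable_const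
    · exact ((measurable_norm_inner_sq_div.comp ((hH k).prodMk (hH l))).const_mul
        (w l)).ennreal_ofReal
  have hL := tendsto_lintegral_of_dominated_convergence (μ := P)
    (F := fun n ω => ψ (H k ω) * expNeg (∑ l ∈ Finset.range n, if l = k then 0 else
        ENNReal.ofReal (w l * (‖inner ℂ (H k ω) (H l ω)‖ ^ 2 / ‖H k ω‖ ^ 2))))
    (f := fun ω => ψ (H k ω) * expNeg (∑' l, if l = k then 0 else
        ENNReal.ofReal (w l * (‖inner ℂ (H k ω) (H l ω)‖ ^ 2 / ‖H k ω‖ ^ 2))))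
    (fun _ => 1)
    (fun n => (hψ.comp (hH k)).mul
      (measurable_expNeg.comp (Finset.measurable_fun_sum _ fun l _ => hgm l)))
    (fun n => ae_of_all _ fun ω => mul_le_one' (hψ1 _) (expNeg_le_one _)) (by simp)
    (ae_of_all _ fun ω => ENNReal.Tendsto.const_mul (tendsto_expNeg_sum_range _)
      (Or.inr (ne_top_of_le_ne_top ENNReal.one_ne_top (hψ1 _))))
  have hψi : ∫⁻ ω, ψ (H k ω) ∂P ≠ ∞ := by
    refine ne_top_of_le_ne_top ENNReal.one_ne_top ?_
    calc ∫⁻ ω, ψ (H k ω) ∂P ≤ ∫⁻ _, 1 ∂P := lintegral_mono fun ω => hψ1 _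
      _ = 1 := by simp
  refine tendsto_nhds_unique hL ?_
  simp_rw [hfin]
  exact ENNReal.Tendsto.const_mul (tendsto_expNeg_sum_range _) (Or.inr hψi)

/-- The signal power after maximum ratio combining is Gamma distributed with shape `N`. -/
lemma lintegral_expNeg_mul_norm_sq [IsProbabilityMeasure P] {h : Ω → EuclideanSpace ℂ (Fin N)}
    (hm : ∀ i, Measurable fun ω => h ω i)
    (hl : ∀ i, HasLaw (fun ω => h ω i) stdComplexGaussian P)
    (hi : iIndepFun (fun i ω => h ω i) P) {s : ℝ} (hs : 0 ≤ s) :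
    ∫⁻ ω, expNeg (ENNReal.ofReal (s * ‖h ω‖ ^ 2)) ∂P = (1 + ENNReal.ofReal s)⁻¹ ^ N := by
  have h1 : ∀ ω, expNeg (ENNReal.ofReal (s * ‖h ω‖ ^ 2)) =
      ∏ i, expNeg (ENNReal.ofReal (s * ‖h ω i‖ ^ 2)) := by
    intro ω
    rw [EuclideanSpace.norm_sq_eq, Finset.mul_sum,
      ENNReal.ofReal_sum_of_nonneg (fun i _ => by positivity), expNeg_sum]
  simp_rw [h1]
  rw [lintegral_prod_eq_prod_lintegral_of_indepFun Finset.univ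
    (fun i ω => expNeg (ENNReal.ofReal (s * ‖h ω i‖ ^ 2)))]
  · have h2 : ∀ i, ∫⁻ ω, expNeg (ENNReal.ofReal (s * ‖h ω i‖ ^ 2)) ∂P =
        (1 + ENNReal.ofReal s)⁻¹ := fun i => by
      rw [← lintegral_expNeg_normSq_stdComplexGaussian hs]
      exact (hl i).lintegral_comp (f := fun z => expNeg (ENNReal.ofReal (s * ‖z‖ ^ 2)))
        (by fun_prop)
    simp [h2]
  · exact hi.comp (fun i z => expNeg (ENNReal.ofReal (s * ‖z‖ ^ 2))) (fun i => by fun_prop)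
  · have h2 : Measurable fun z : ℂ => expNeg (ENNReal.ofReal (s * ‖z‖ ^ 2)) := by fun_prop
    exact fun i => h2.comp (hm i)

lemma ae_ne_zero_of_hasLaw_stdComplexGaussian {h : Ω → EuclideanSpace ℂ (Fin N)} (i : Fin N)
    (hl : HasLaw (fun ω => h ω i) stdComplexGaussian P) : ∀ᵐ ω ∂P, h ω ≠ 0 := by
  have h1 : ∀ᵐ z ∂stdComplexGaussian, z ≠ 0 := by
    rw [stdComplexGaussian, ae_map_iff (p := fun z : ℂ => z ≠ 0) measurable_complex_mk.aemeasurable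
      (measurableSet_singleton (0 : ℂ)).compl]
    have : NullSingletonClass (gaussianReal 0 (1 / 2)) :=
      nullSingletonClass_gaussianReal (by norm_num)
    have h2 : ∀ᵐ x ∂gaussianReal 0 (1 / 2), x ≠ 0 := by
      rw [ae_iff]
      simp only [ne_eq, not_not, Set.ofPred_eq_eq_singleton]
      exact measure_singleton 0
    have h3 := Measure.quasiMeasurePreserving_fst (μ := gaussianReal 0 (1 / 2))
      (ν := gaussianReal 0 (1 / 2)) |>.ae h2
    filter_upwards [h3] with p hp h0
    exact hp (congrArg Complex.re h0)
  rw [← hl.map_eq] at h1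
  filter_upwards [ae_of_ae_map hl.aemeasurable h1] with ω hω h0
  exact hω (by simp [h0])

end Fading

/-! ### The double integral -/

section Integrand

variable {lam : ℝ} {N : ℕ} {α SNR : ℝ}

/-- The integrand of the formula in terms of `t = (u / c) ^ (α / 2)`, where
`c = λ π / sinc (2 / α)`. -/
lemma mrcIntegrand_eq (hlam : 0 < lam) (hα : 2 < α) {r u : ℝ} (hr : 0 < r) (hu : 0 < u) :
    mrcIntegrand lam N α SNR r u =
      Real.exp (-((u / (lam * Real.pi / nsinc (2 / α))) ^ (α / 2) * (1 / SNR))) *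
        Real.exp (-u) / u * (1 - (1 + (u / (lam * Real.pi / nsinc (2 / α))) ^ (α / 2) * r ^ (-α))⁻¹ ^ N) := by
  have hs := nsinc_pos hα
  have hpi := Real.pi_pos
  set s := nsinc (2 / α)
  have hα0 : 0 < α := by linarith
  have e1 : u / (lam * Real.pi / s) = s * u / (lam * Real.pi) := by field_simp
  have e2 : (s * u / (lam * Real.pi * r ^ 2)) ^ (α / 2) =
      (u / (lam * Real.pi / s)) ^ (α / 2) * r ^ (-α) := by
    rw [e1, ← div_div, Real.div_rpow (by positivity) (by positivity), Real.rpow_neg hr.le,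
      ← Real.rpow_natCast r 2, ← Real.rpow_mul hr.le, div_eq_mul_inv]
    congr 3
    push_cast
    ring
  have e3 : (s * u) ^ (α / 2) / ((lam * Real.pi) ^ (α / 2) * SNR) =
      (u / (lam * Real.pi / s)) ^ (α / 2) * (1 / SNR) := by
    rw [e1, Real.div_rpow (by positivity) (by positivity), mul_one_div, div_div]
  unfold mrcIntegrand
  rw [e3, e2, sub_eq_add_neg, Real.exp_add]
  congr 1
  set y := (u / (lam * Real.pi / s)) ^ (α / 2) * r ^ (-α) with hy
  have hy0 : 0 ≤ y := by positivity
  have e4 : ∑ n ∈ Finset.Icc 1 N, (N.choose n : ℝ) *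
        (s * u / (lam * Real.pi * r ^ 2)) ^ ((n : ℝ) * (α / 2)) = (1 + y) ^ N - 1 := by
    have h1 : ∀ n ∈ Finset.Icc 1 N, (N.choose n : ℝ) *
        (s * u / (lam * Real.pi * r ^ 2)) ^ ((n : ℝ) * (α / 2)) = y ^ n * (N.choose n : ℝ) := by
      intro n _
      rw [mul_comm (n : ℝ), Real.rpow_mul (by positivity), e2, Real.rpow_natCast]
      ring
    rw [Finset.sum_congr rfl h1, add_comm (1 : ℝ), add_pow, Finset.range_eq_Ico,
      Finset.sum_eq_sum_Ico_succ_bot (Nat.succ_pos N)]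
    simp only [one_pow, mul_one, pow_zero, Nat.choose_zero_right, Nat.cast_one, zero_add]
    rw [add_sub_cancel_left]
    rfl
  rw [e4, inv_pow]
  have : (1 + y) ^ N ≠ 0 := by positivity
  field_simp

lemma one_sub_inv_pow_nonneg {y : ℝ} (hy : 0 ≤ y) (N : ℕ) : 0 ≤ 1 - (1 + y)⁻¹ ^ N := by
  have : (1 + y)⁻¹ ^ N ≤ 1 := pow_le_one₀ (by positivity) (inv_le_one_of_one_le₀ (by linarith))
  linarith

lemma one_sub_inv_pow_le {y : ℝ} (hy : 0 ≤ y) (N : ℕ) : 1 - (1 + y)⁻¹ ^ N ≤ N * y := by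
  have h0 : 0 < (1 + y)⁻¹ := by positivity
  have h1 := one_add_mul_le_pow (a := (1 + y)⁻¹ - 1) (by linarith) N
  rw [add_sub_cancel] at h1
  have h2 : 1 - (1 + y)⁻¹ ≤ y := by
    have : 1 - (1 + y)⁻¹ = y / (1 + y) := by field_simp; ring
    rw [this]
    exact div_le_self hy (by linarith)
  have h3 : (N : ℝ) * (1 - (1 + y)⁻¹) ≤ N * y := by gcongr
  linarith

lemma mrcIntegrand_nonneg (hlam : 0 < lam) (hα : 2 < α) {r u : ℝ} (hr : 0 < r) (hu : 0 < u) :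
    0 ≤ mrcIntegrand lam N α SNR r u := by
  rw [mrcIntegrand_eq hlam hα hr hu]
  have hs := nsinc_pos hα
  have hpi := Real.pi_pos
  exact mul_nonneg (by positivity) (one_sub_inv_pow_nonneg (by positivity) N)

/-- A bound uniform in `r ≥ 1`; the singularity of the factor `1 / u` at `u = 0` is compensated
since `α / 2 > 0`. -/
lemma mrcIntegrand_le (hlam : 0 < lam) (hα : 2 < α) (hSNR : 0 < SNR) {r u : ℝ} (hr : 1 ≤ r)
    (hu : 0 < u) :
    mrcIntegrand lam N α SNR r u ≤
      N * ((lam * Real.pi / nsinc (2 / α)) ^ (α / 2))⁻¹ *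
        (Real.exp (-u) * u ^ (α / 2 - 1)) := by
  rw [mrcIntegrand_eq hlam hα (by linarith) hu]
  have hs := nsinc_pos hα
  have hpi := Real.pi_pos
  set c := lam * Real.pi / nsinc (2 / α) with hc
  have hc0 : 0 < c := by positivity
  set T := (u / c) ^ (α / 2) with hT
  have hT0 : 0 < T := by positivity
  have hrα : r ^ (-α) ≤ 1 := Real.rpow_le_one_of_one_le_of_nonpos hr (by linarith)
  have hr0 : 0 ≤ r ^ (-α) := Real.rpow_nonneg (by linarith) _
  have h1 : Real.exp (-(T * (1 / SNR))) ≤ 1 := Real.exp_le_one_iff.2 (by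
    have : 0 ≤ T * (1 / SNR) := by positivity
    linarith)
  have h2 : 1 - (1 + T * r ^ (-α))⁻¹ ^ N ≤ N * T := by
    refine (one_sub_inv_pow_le (by positivity) N).trans ?_
    gcongr
    exact mul_le_of_le_one_right hT0.le hrα
  calc Real.exp (-(T * (1 / SNR))) * Real.exp (-u) / u * (1 - (1 + T * r ^ (-α))⁻¹ ^ N)
      ≤ 1 * Real.exp (-u) / u * (N * T) := by
        gcongr
        exact one_sub_inv_pow_nonneg (by positivity) N
    _ = _ := by
        rw [hT, Real.div_rpow hu.le hc0.le, Real.rpow_sub_one hu.ne']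
        field_simp

lemma measurable_mrcIntegrand : Measurable fun p : ℝ × ℝ => mrcIntegrand lam N α SNR p.1 p.2 := by
  unfold mrcIntegrand
  fun_prop

lemma integrableOn_mrcIntegrand_bound (hα : 2 < α) (C : ℝ) :
    IntegrableOn (fun u => C * (Real.exp (-u) * u ^ (α / 2 - 1))) (Set.Ioi 0) :=
  (Real.GammaIntegral_convergent (by linarith)).const_mul C

lemma integrableOn_mrcIntegrand (hlam : 0 < lam) (hα : 2 < α) (hSNR : 0 < SNR) {r : ℝ}
    (hr : 1 ≤ r) : IntegrableOn (mrcIntegrand lam N α SNR r) (Set.Ioi 0) := by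
  refine Integrable.mono' (integrableOn_mrcIntegrand_bound hα
      (N * ((lam * Real.pi / nsinc (2 / α)) ^ (α / 2))⁻¹)) ?_ ?_
  · exact (measurable_mrcIntegrand.comp measurable_prodMk_left).aestronglyMeasurable
  · refine (ae_restrict_iff' measurableSet_Ioi).2 (ae_of_all _ fun u (hu : 0 < u) => ?_)
    rw [Real.norm_of_nonneg (mrcIntegrand_nonneg hlam hα (by linarith) hu)]
    exact mrcIntegrand_le hlam hα hSNR hr hu

lemma intervalIntegrable_integral_mrcIntegrand (hlam : 0 < lam) (hα : 2 < α) (hSNR : 0 < SNR)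
    {R : ℝ} (hR : 1 < R) :
    IntervalIntegrable
      (fun r => (∫ u in Set.Ioi 0, mrcIntegrand lam N α SNR r u) * (2 * r / (R ^ 2 - 1)))
      volume 1 R := by
  rw [intervalIntegrable_iff_integrableOn_Ioc_of_le hR.le]
  set C := ∫ u in Set.Ioi 0, N * ((lam * Real.pi / nsinc (2 / α)) ^ (α / 2))⁻¹ *
        (Real.exp (-u) * u ^ (α / 2 - 1))
  have hR2 : 0 < R ^ 2 - 1 := by nlinarith
  have hm : StronglyMeasurable fun r => ∫ u in Set.Ioi 0, mrcIntegrand lam N α SNR r u :=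
    measurable_mrcIntegrand.stronglyMeasurable.integral_prod_right
  refine Integrable.mono' (g := fun _ => C * (2 * R / (R ^ 2 - 1))) (integrable_const _) ?_ ?_
  · exact hm.aestronglyMeasurable.mul (by fun_prop)
  · refine (ae_restrict_iff' measurableSet_Ioc).2 (ae_of_all _ fun r hr => ?_)
    have hr0 : 0 < r := by linarith [hr.1]
    have h0 : 0 ≤ ∫ u in Set.Ioi 0, mrcIntegrand lam N α SNR r u :=
      setIntegral_nonneg measurableSet_Ioi fun u hu => mrcIntegrand_nonneg hlam hα hr0 hu
    have hle : ∫ u in Set.Ioi 0, mrcIntegrand lam N α SNR r u ≤ C :=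
      setIntegral_mono_on (integrableOn_mrcIntegrand hlam hα hSNR hr.1.le)
        (integrableOn_mrcIntegrand_bound hα _) measurableSet_Ioi
        fun u hu => mrcIntegrand_le hlam hα hSNR hr.1.le hu
    rw [Real.norm_of_nonneg (by positivity)]
    have := hr.2
    have := h0.trans hle
    gcongr

/-- The substitution `t = (u / c) ^ (α / 2)`, where `c = λ π / sinc (2 / α)`. -/
lemma lintegral_laplace_eq_lintegral_mrcIntegrand (hlam : 0 < lam) (hα : 2 < α) {r : ℝ}
    (hr : 0 < r) :
    ∫⁻ t in Set.Ioi 0, ENNReal.ofReal (t⁻¹ * Real.exp (-(t * (1 / SNR))) *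
        Real.exp (-(lam * Real.pi / nsinc (2 / α) * t ^ (2 / α))) *
        (1 - (1 + t * r ^ (-α))⁻¹ ^ N)) =
      ∫⁻ u in Set.Ioi 0, ENNReal.ofReal (α / 2 * mrcIntegrand lam N α SNR r u) := by
  have hs := nsinc_pos hα
  have hpi := Real.pi_pos
  have hα0 : 0 < α := by linarith
  set c := lam * Real.pi / nsinc (2 / α) with hc
  have hc0 : 0 < c := by positivity
  let f : ℝ → ℝ := fun u => (u / c) ^ (α / 2)
  have hfinv : ∀ u, 0 < u → c * f u ^ (2 / α) = u := by
    intro u hu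
    simp only [f]
    rw [← Real.rpow_mul (by positivity), show α / 2 * (2 / α) = 1 by field_simp, Real.rpow_one]
    field_simp
  have himg : f '' Set.Ioi 0 = Set.Ioi 0 := by
    ext t
    constructor
    · rintro ⟨u, hu, rfl⟩
      have hu' : 0 < u := hu
      exact Set.mem_Ioi.2 (by positivity)
    · intro (ht : 0 < t)
      refine ⟨c * t ^ (2 / α), Set.mem_Ioi.2 (by positivity), ?_⟩
      simp only [f]
      rw [mul_div_cancel_left₀ _ hc0.ne', ← Real.rpow_mul ht.le,
        show 2 / α * (α / 2) = 1 by field_simp, Real.rpow_one]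
  have hinj : Set.InjOn f (Set.Ioi 0) := by
    intro u hu v hv huv
    rw [← hfinv u hu, ← hfinv v hv, huv]
  have hder : ∀ u ∈ Set.Ioi (0 : ℝ),
      HasDerivWithinAt f (α / 2 * f u / u) (Set.Ioi 0) u := by
    intro u (hu : 0 < u)
    have h1 := ((hasDerivAt_id u).div_const c).rpow_const (p := α / 2)
      (Or.inl (by simp; exact ⟨hu.ne', hc0.ne'⟩))
    convert! h1.hasDerivWithinAt using 1
    simp only [f, id]
    rw [Real.rpow_sub_one (by positivity)]
    field_simp
  rw [← himg, lintegral_image_eq_lintegral_abs_deriv_mul measurableSet_Ioi hder hinj, himg]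
  refine setLIntegral_congr_fun measurableSet_Ioi fun u (hu : 0 < u) => ?_
  have hfu : 0 < f u := by positivity
  rw [abs_of_nonneg (by positivity), ← ENNReal.ofReal_mul (by positivity)]
  congr 1
  rw [hfinv u hu, mrcIntegrand_eq hlam hα hr hu]
  change _ = α / 2 * (Real.exp (-(f u * (1 / SNR))) * Real.exp (-u) / u *
    (1 - (1 + f u * r ^ (-α))⁻¹ ^ N))
  field_simp

/-- The double integral of the formula as an iterated lower integral in the Laplace variable. -/
lemma lintegral_lintegral_laplace_eq (hlam : 0 < lam) (hα : 2 < α) (hSNR : 0 < SNR)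
    {R : ℝ} (hR : 1 < R) :
    ∫⁻ r in Set.Ioc 1 R, ENNReal.ofReal (2 * r / (R ^ 2 - 1)) *
      ∫⁻ t in Set.Ioi 0, ENNReal.ofReal (t⁻¹ * Real.exp (-(t * (1 / SNR))) *
        Real.exp (-(lam * Real.pi / nsinc (2 / α) * t ^ (2 / α))) *
        (1 - (1 + t * r ^ (-α))⁻¹ ^ N)) =
      ENNReal.ofReal (α / 2 * ∫ r in (1 : ℝ)..R,
        (∫ u in Set.Ioi 0, mrcIntegrand lam N α SNR r u) * (2 * r / (R ^ 2 - 1))) := by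
  have hR2 : 0 < R ^ 2 - 1 := by nlinarith
  have hα0 : 0 < α := by linarith
  have h1 : ∀ r ∈ Set.Ioc 1 R, ENNReal.ofReal (2 * r / (R ^ 2 - 1)) *
      ∫⁻ t in Set.Ioi 0, ENNReal.ofReal (t⁻¹ * Real.exp (-(t * (1 / SNR))) *
        Real.exp (-(lam * Real.pi / nsinc (2 / α) * t ^ (2 / α))) *
        (1 - (1 + t * r ^ (-α))⁻¹ ^ N)) =
      ENNReal.ofReal (α / 2 * ((∫ u in Set.Ioi 0, mrcIntegrand lam N α SNR r u) *
        (2 * r / (R ^ 2 - 1)))) := by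
    intro r hr
    have hr0 : 0 < r := by linarith [hr.1]
    rw [lintegral_laplace_eq_lintegral_mrcIntegrand hlam hα hr0,
      ← ofReal_integral_eq_lintegral_ofReal
        ((integrableOn_mrcIntegrand hlam hα hSNR hr.1.le).const_mul _)
        ((ae_restrict_iff' measurableSet_Ioi).2 (ae_of_all _ fun u hu =>
          mul_nonneg (by positivity) (mrcIntegrand_nonneg hlam hα hr0 hu))),
      integral_const_mul, ← ENNReal.ofReal_mul (by positivity)]
    congr 1
    ring
  have hint := (intervalIntegrable_iff_integrableOn_Ioc_of_le hR.le).1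
    (intervalIntegrable_integral_mrcIntegrand (N := N) hlam hα hSNR hR)
  rw [setLIntegral_congr_fun measurableSet_Ioc h1,
    ← ofReal_integral_eq_lintegral_ofReal (hint.const_mul _), integral_const_mul,
    intervalIntegral.integral_of_le hR.le]
  refine (ae_restrict_iff' measurableSet_Ioc).2 (ae_of_all _ fun r hr => ?_)
  have hr0 : 0 < r := by linarith [hr.1]
  have h0 : 0 ≤ ∫ u in Set.Ioi 0, mrcIntegrand lam N α SNR r u :=
    setIntegral_nonneg measurableSet_Ioi fun u hu => mrcIntegrand_nonneg hlam hα hr0 hu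
  exact mul_nonneg (by positivity) (by positivity)

end Integrand

/-! ### The network -/

namespace Network

section Measurability

variable {Ω : Type*} [MeasurableSpace Ω] {N : ℕ} {net : Network Ω N}

lemma measurable_dist (htx : ∀ k, Measurable (net.tx k)) (hlink : ∀ k, Measurable (net.link k))
    (k l : ℕ) : Measurable (net.dist k l) :=
  (((htx k).add (hlink k)).sub (htx l)).norm

lemma measurable_gain (hf : ∀ k l i, Measurable fun ω => net.fading k l ω i) (k l : ℕ) :
    Measurable (net.gain k l) := by
  have h1 : Measurable (net.fading k k) := measurable_euclideanSpace_of_apply (hf k k)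
  have h2 : Measurable (net.fading k l) := measurable_euclideanSpace_of_apply (hf k l)
  have h3 : net.gain k l = (fun p : EuclideanSpace ℂ (Fin N) × EuclideanSpace ℂ (Fin N) =>
      ‖inner ℂ p.1 p.2‖ ^ 2 / ‖p.1‖ ^ 2) ∘ fun ω => (net.fading k k ω, net.fading k l ω) := by
    funext ω
    simp only [gain, Function.comp]
  rw [h3]
  exact measurable_norm_inner_sq_div.comp (h1.prodMk h2)

lemma measurable_interference (htx : ∀ k, Measurable (net.tx k))
    (hlink : ∀ k, Measurable (net.link k)) (hf : ∀ k l i, Measurable fun ω => net.fading k l ω i)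
    (α : ℝ) (k : ℕ) : Measurable (net.interference α k) := by
  refine Measurable.tsum fun l => ?_
  split_ifs
  · exact measurable_const
  · exact ((measurable_gain hf k l).mul
      ((measurable_dist htx hlink k l).pow_const _)).ennreal_ofReal

end Measurability

variable {Ω : Type*} {N : ℕ} (net : Network Ω N)

/-- The integrand `(1 - exp (-t S)) exp (-t I)` of the Frullani-type formula for the spectral
efficiency of link `k`, where `S` and `I` are the powers of signal and interference. -/
noncomputable def laplaceKernel (α : ℝ) (k : ℕ) (t : ℝ) (ω : Ω) : ℝ≥0∞ :=
  (1 - expNeg (ENNReal.ofReal t * ENNReal.ofReal (net.gain k k ω * net.dist k k ω ^ (-α)))) *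
    expNeg (ENNReal.ofReal t * net.interference α k ω)

lemma gain_nonneg (k l : ℕ) (ω : Ω) : 0 ≤ net.gain k l ω := by
  unfold gain; positivity

lemma dist_nonneg (k l : ℕ) (ω : Ω) : 0 ≤ net.dist k l ω := norm_nonneg _

/-- This also holds when the combining vector vanishes, as `0 / 0 = 0`. -/
lemma gain_self (k : ℕ) (ω : Ω) : net.gain k k ω = ‖net.fading k k ω‖ ^ 2 := by
  unfold gain
  rw [inner_self_eq_norm_sq_to_K]
  rcases eq_or_ne ‖net.fading k k ω‖ 0 with h | h
  · simp [h]
  · simp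
    field_simp

lemma rate_eq_lintegral {α SNR : ℝ} (hSNR : 0 < SNR) (k : ℕ) (ω : Ω) :
    net.rate α SNR k ω = ENNReal.ofReal (1 / Real.log 2) *
      ∫⁻ t in Set.Ioi 0, (ENNReal.ofReal t)⁻¹ *
        (expNeg (ENNReal.ofReal t * ENNReal.ofReal (1 / SNR)) * net.laplaceKernel α k t ω) := by
  have hS : 0 ≤ net.gain k k ω * net.dist k k ω ^ (-α) :=
    mul_nonneg (net.gain_nonneg k k ω) (Real.rpow_nonneg (net.dist_nonneg k k ω) _)
  have hlog : 0 < Real.log 2 := Real.log_pos (by norm_num)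
  unfold laplaceKernel
  rw [← ofReal_log_one_add_div_eq_lintegral _ hS (by positivity),
    ← ENNReal.ofReal_mul (by positivity)]
  unfold rate sinr Real.logb
  congr 1
  ring

section Measurability

variable [MeasurableSpace Ω] {net}

lemma measurable_laplaceKernel (htx : ∀ k, Measurable (net.tx k))
    (hlink : ∀ k, Measurable (net.link k)) (hf : ∀ k l i, Measurable fun ω => net.fading k l ω i)
    (α : ℝ) (k : ℕ) : Measurable fun p : ℝ × Ω => net.laplaceKernel α k p.1 p.2 := by
  have h1 := measurable_interference htx hlink hf α k
  have h2 := measurable_gain hf k k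
  have h3 := measurable_dist htx hlink k k
  have h4 : Measurable fun ω =>
      ENNReal.ofReal (net.gain k k ω * net.dist k k ω ^ (-α)) :=
    (h2.mul (h3.pow_const _)).ennreal_ofReal
  have h5 : Measurable fun p : ℝ × Ω => ENNReal.ofReal p.1 := measurable_fst.ennreal_ofReal
  exact (measurable_const.sub (measurable_expNeg.comp (h5.mul (h4.comp measurable_snd)))).mul
    (measurable_expNeg.comp (h5.mul (h1.comp measurable_snd)))

end Measurability

namespace IsModel

variable [MeasurableSpace Ω] {P : Measure Ω} {net} {lam R : ℝ}

/-- Averaging over the fading for a fixed geometry `x`, `v` of transmitters and links. -/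
lemma lintegral_laplaceKernel_fading [IsProbabilityMeasure P] (hnet : net.IsModel P lam R)
    (hN : 1 ≤ N) (α : ℝ) (k : ℕ) {t : ℝ} (ht : 0 < t) (x v : ℕ → Plane) :
    ∫⁻ ω, ({tx := fun k _ => x k, link := fun k _ => v k, fading := net.fading} :
        Network Ω N).laplaceKernel α k t ω ∂P =
      (1 - (1 + ENNReal.ofReal (t * ‖v k‖ ^ (-α)))⁻¹ ^ N) *
        expNeg (∑' l, if l = k then 0 else
          (ENNReal.log (1 + ENNReal.ofReal (t * ‖x k + v k - x l‖ ^ (-α)))).toENNReal) := by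
  let w : ℕ → ℝ := fun l => t * ‖x k + v k - x l‖ ^ (-α)
  have hw : ∀ l, 0 ≤ w l := fun l => mul_nonneg ht.le (Real.rpow_nonneg (norm_nonneg _) _)
  have hwk : w k = t * ‖v k‖ ^ (-α) := by simp [w]
  let ψ : EuclideanSpace ℂ (Fin N) → ℝ≥0∞ := fun a => 1 - expNeg (ENNReal.ofReal (w k * ‖a‖ ^ 2))
  have hψ : Measurable ψ := by fun_prop
  have hi : iIndepFun (fun (q : ℕ × Fin N) ω => net.fading k q.1 ω q.2) P :=
    hnet.indep_fading.precomp (g := fun q : ℕ × Fin N => (k, q)) fun a b hab => (Prod.mk.inj hab).2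
  have hik : iIndepFun (fun i ω => net.fading k k ω i) P :=
    hi.precomp (g := fun i : Fin N => (k, i)) fun a b hab => (Prod.mk.inj hab).2
  have hm := hnet.measurable_fading k
  have hl := hnet.law_fading k
  have hmain := lintegral_mul_expNeg_tsum_gain hm hl hi
    (ae_ne_zero_of_hasLaw_stdComplexGaussian ⟨0, hN⟩ (hl k _)) hψ (fun a => tsub_le_self) hw
  have hψi : ∫⁻ ω, ψ (net.fading k k ω) ∂P = 1 - (1 + ENNReal.ofReal (w k))⁻¹ ^ N := by
    have h1 := lintegral_expNeg_mul_norm_sq (hm k) (hl k) hik (hw k)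
    rw [lintegral_sub, h1]
    · simp
    · exact (by fun_prop : Measurable fun a : EuclideanSpace ℂ (Fin N) =>
        expNeg (ENNReal.ofReal (w k * ‖a‖ ^ 2))).comp (measurable_euclideanSpace_of_apply (hm k))
    · rw [h1]
      exact ENNReal.pow_ne_top (by simp)
    · exact ae_of_all _ fun ω => expNeg_le_one _
  rw [hψi, hwk] at hmain
  rw [← hmain]
  refine lintegral_congr fun ω => ?_
  unfold laplaceKernel
  rw [gain_self]
  congr 1
  · simp only [ψ]
    rw [← ENNReal.ofReal_mul ht.le, hwk]
    congr 3
    simp only [dist, rx, add_sub_cancel_left]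
    ring
  · congr 1
    unfold interference
    rw [← ENNReal.tsum_mul_left]
    refine tsum_congr fun l => ?_
    split_ifs
    · simp
    · rw [← ENNReal.ofReal_mul ht.le]
      congr 1
      simp only [w, gain, dist, rx]
      ring

lemma measurable_tx_seq (hnet : net.IsModel P lam R) : Measurable fun ω k => net.tx k ω :=
  measurable_pi_lambda _ hnet.ppp.measurable

lemma measurable_link_seq (hnet : net.IsModel P lam R) : Measurable fun ω k => net.link k ω :=
  measurable_pi_lambda _ hnet.measurable_link

lemma indepFun_link_tx (hnet : net.IsModel P lam R) (k : ℕ) :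
    IndepFun (net.link k) (fun ω k => net.tx k ω) P :=
  hnet.indep_tx_link.symm.comp (measurable_pi_apply k) measurable_id

/-- The fading can be averaged out before the geometry. -/
lemma lintegral_indicator_mul_laplaceKernel [IsProbabilityMeasure P] (hnet : net.IsModel P lam R)
    (hN : 1 ≤ N) (α : ℝ) (k : ℕ) {t : ℝ} (ht : 0 < t) {A : Set Plane} (hA : MeasurableSet A) :
    ∫⁻ ω, A.indicator (fun _ => 1) (net.tx k ω) * net.laplaceKernel α k t ω ∂P =
      ∫⁻ ω, (1 - (1 + ENNReal.ofReal (t * ‖net.link k ω‖ ^ (-α)))⁻¹ ^ N) *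
        (A.indicator (fun _ => 1) (net.tx k ω) * expNeg (∑' l, if l = k then 0 else
          (ENNReal.log (1 + ENNReal.ofReal
            (t * ‖net.tx k ω + net.link k ω - net.tx l ω‖ ^ (-α)))).toENNReal)) ∂P := by
  -- the network on the canonical space of all geometries and fading coefficients
  let net₀ : Network (((ℕ → Plane) × (ℕ → Plane)) × (ℕ → ℕ → Fin N → ℂ)) N :=
    { tx := fun k p => p.1.1 k
      link := fun k p => p.1.2 k
      fading := fun k l p => WithLp.toLp 2 (p.2 k l) }
  have htx : ∀ k, Measurable (net₀.tx k) := fun k =>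
    (measurable_pi_apply k).comp (measurable_fst.comp measurable_fst)
  have hlink : ∀ k, Measurable (net₀.link k) := fun k =>
    (measurable_pi_apply k).comp (measurable_snd.comp measurable_fst)
  have hfad : ∀ k l i, Measurable fun p => net₀.fading k l p i := fun k l i =>
    (measurable_pi_apply i).comp ((measurable_pi_apply l).comp
      ((measurable_pi_apply k).comp measurable_snd))
  have hK := (measurable_laplaceKernel htx hlink hfad α k).comp (measurable_prodMk_left (x := t))
  have hF : Measurable fun ω k l i => net.fading k l ω i :=
    measurable_pi_lambda _ fun k => measurable_pi_lambda _ fun l => measurable_pi_lambda _ fun i =>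
      hnet.measurable_fading k l i
  have hind : Measurable fun p => A.indicator (fun _ => (1 : ℝ≥0∞)) (net₀.tx k p) :=
    (measurable_const.indicator hA).comp (htx k)
  have h := hnet.indep_geometry_fading.lintegral_comp_prodMk
    (hnet.measurable_tx_seq.prodMk hnet.measurable_link_seq) hF
    (f := fun g y => A.indicator (fun _ => 1) (g.1 k) * net₀.laplaceKernel α k t (g, y))
    (hind.mul hK)
  refine h.trans (lintegral_congr fun ω => ?_)
  have h2 := hnet.lintegral_laplaceKernel_fading hN α k ht (fun k => net.tx k ω)
    (fun k => net.link k ω)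
  rw [lintegral_const_mul', mul_left_comm, ← h2]
  · rfl
  · by_cases hk : net.tx k ω ∈ A <;> simp [hk]

/-- Almost surely no receiver sits on a transmitter. -/
lemma ae_tx_add_link_sub_tx_ne_zero [IsProbabilityMeasure P] (hnet : net.IsModel P lam R)
    (k l : ℕ) : ∀ᵐ ω ∂P, net.tx k ω + net.link k ω - net.tx l ω ≠ 0 := by
  have hs : MeasurableSet {q : (ℕ → Plane) × Plane | q.1 k + q.2 - q.1 l = 0} :=
    measurableSet_eq_fun (by fun_prop) measurable_const
  have hf : Measurable fun q : (ℕ → Plane) × Plane =>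
      {q : (ℕ → Plane) × Plane | q.1 k + q.2 - q.1 l = 0}.indicator (fun _ => (1 : ℝ≥0∞)) q :=
    measurable_const.indicator hs
  have hmeas : Measurable fun ω => ((fun k => net.tx k ω, net.link k ω) : (ℕ → Plane) × Plane) :=
    hnet.measurable_tx_seq.prodMk (hnet.measurable_link k)
  have hac : ∀ v : Plane, P {ω | net.link k ω = v} = 0 := by
    intro v
    have h1 : P.map (net.link k) {v} = 0 := by
      rw [hnet.uniform_link k]
      exact cond_absolutelyContinuous (measure_singleton v)
    rwa [Measure.map_apply (hnet.measurable_link k) (measurableSet_singleton v)] at h1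
  have h := (hnet.indepFun_link_tx k).symm.lintegral_comp_prodMk hnet.measurable_tx_seq
    (hnet.measurable_link k) (f := fun x v =>
      {q : (ℕ → Plane) × Plane | q.1 k + q.2 - q.1 l = 0}.indicator (fun _ => (1 : ℝ≥0∞)) (x, v)) hf
  have h0 : ∀ ω, ∫⁻ ω', {q : (ℕ → Plane) × Plane | q.1 k + q.2 - q.1 l = 0}.indicator
      (fun _ => (1 : ℝ≥0∞)) (fun k => net.tx k ω, net.link k ω') ∂P = 0 := by
    intro ω
    have hset : MeasurableSet {ω' | net.link k ω' = net.tx l ω - net.tx k ω} :=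
      measurableSet_eq_fun (hnet.measurable_link k) measurable_const
    rw [← hac (net.tx l ω - net.tx k ω), ← lintegral_indicator_one hset]
    refine lintegral_congr fun ω' => ?_
    simp only [Set.indicator, Set.mem_ofPred_eq, Pi.one_apply]
    congr 1
    rw [eq_iff_iff, sub_eq_zero, eq_sub_iff_add_eq, add_comm]
  simp_rw [h0, lintegral_zero] at h
  filter_upwards [(lintegral_eq_zero_iff (hf.comp hmeas)).1 h] with ω hω h1
  simp [h1] at hω

/-- The uniform law of the link vectors in polar coordinates. -/
lemma lintegral_map_link (hnet : net.IsModel P lam R) (hR : 1 < R) {f : ℝ → ℝ≥0∞}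
    (hf : Measurable f) (k : ℕ) : ∫⁻ v, f ‖v‖ ∂(P.map (net.link k)) =
      ∫⁻ r in Set.Ioc 1 R, ENNReal.ofReal (2 * r / (R ^ 2 - 1)) * f r := by
  have hR2 : 0 < R ^ 2 - 1 := by nlinarith
  have hpi := Real.pi_pos
  have hvol : volume (annulus R) = ENNReal.ofReal (Real.pi * (R ^ 2 - 1)) := by
    have h1 := lintegral_annulus (R := R) (f := fun _ => 1) measurable_const
    simp only [lintegral_const, Measure.restrict_apply_univ, one_mul, mul_one] at h1
    rw [h1, ← ofReal_integral_eq_lintegral_ofReal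
      ((by fun_prop : Continuous fun r => 2 * Real.pi * r).integrableOn_Ioc)
      ((ae_restrict_iff' measurableSet_Ioc).2 (ae_of_all _ fun r hr => by
        have := hr.1
        positivity)), ← intervalIntegral.integral_of_le hR.le,
      intervalIntegral.integral_const_mul, integral_id]
    congr 1
    ring
  rw [hnet.uniform_link k, ProbabilityTheory.cond, lintegral_smul_measure, lintegral_annulus hf,
    hvol, smul_eq_mul, ← lintegral_const_mul _ (by fun_prop)]
  refine setLIntegral_congr_fun measurableSet_Ioc fun r hr => ?_
  have hr0 : 0 < r := by linarith [hr.1]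
  rw [← mul_assoc, ← ENNReal.ofReal_inv_of_pos (by positivity),
    ← ENNReal.ofReal_mul (by positivity)]
  congr 2
  field_simp

end IsModel
end Network

/-! ### Averaging over the point process -/

/-- The exponent `log (1 + t d ^ (-α))` by which an interferer at distance `d` enters the Laplace
transform of the interference at `t`. It is infinite at `d = 0`, whereas the real power `0 ^ (-α)`
is `0`. -/
noncomputable def interfererExponent (α t d : ℝ) : ℝ≥0∞ :=
  (ENNReal.log (1 + ENNReal.ofReal t * ENNReal.ofReal d ^ (-α))).toENNReal

lemma expNeg_interfererExponent (α t d : ℝ) : expNeg (interfererExponent α t d) =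
    (1 + ENNReal.ofReal t * ENNReal.ofReal d ^ (-α))⁻¹ := expNeg_log _

lemma interfererExponent_of_pos (α : ℝ) {t d : ℝ} (ht : 0 ≤ t) (hd : 0 < d) :
    interfererExponent α t d = (ENNReal.log (1 + ENNReal.ofReal (t * d ^ (-α)))).toENNReal := by
  rw [interfererExponent, ENNReal.ofReal_rpow_of_pos hd, ENNReal.ofReal_mul ht]

lemma continuous_interfererExponent (α t : ℝ) : Continuous (interfererExponent α t) := by
  refine EReal.continuous_toENNReal.comp (ENNReal.continuous_log.comp
    (continuous_const.add ((ENNReal.continuous_const_mul ENNReal.ofReal_ne_top).comp ?_)))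
  exact ENNReal.continuous_rpow_const.comp ENNReal.continuous_ofReal

lemma antitone_interfererExponent {α : ℝ} (hα : 0 ≤ α) (t : ℝ) :
    Antitone (interfererExponent α t) := by
  intro a b hab
  refine EReal.toENNReal_le_toENNReal (ENNReal.log_monotone ?_)
  gcongr 1 + _ * ?_
  rw [ENNReal.rpow_neg, ENNReal.rpow_neg]
  gcongr

lemma interfererExponent_ne_top (α t : ℝ) {d : ℝ} (hd : 0 < d) :
    interfererExponent α t d ≠ ∞ := by
  unfold interfererExponent
  rw [ENNReal.ofReal_rpow_of_pos hd]
  simp [ENNReal.mul_eq_top]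

lemma one_sub_inv_pow_eq_ofReal {y : ℝ} (hy : 0 ≤ y) (N : ℕ) :
    1 - (1 + ENNReal.ofReal y)⁻¹ ^ N = ENNReal.ofReal (1 - (1 + y)⁻¹ ^ N) := by
  rw [ENNReal.ofReal_sub _ (by positivity), ENNReal.ofReal_pow (by positivity),
    ENNReal.ofReal_inv_of_pos (by positivity), ENNReal.ofReal_add zero_le_one hy,
    ENNReal.ofReal_one]

lemma lintegral_tsum_lintegral_comm {β γ : Type*} [MeasurableSpace β] [MeasurableSpace γ]
    {μ : Measure β} {ν : Measure γ} [SFinite μ] [SFinite ν] {f : ℕ → γ → β → ℝ≥0∞}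
    (hf : ∀ k, Measurable fun p : γ × β => f k p.1 p.2) :
    ∫⁻ x, ∑' k, ∫⁻ y, f k y x ∂ν ∂μ = ∫⁻ y, ∑' k, ∫⁻ x, f k y x ∂μ ∂ν := by
  rw [lintegral_tsum fun k => (hf k).lintegral_prod_left'.aemeasurable,
    lintegral_tsum fun k => (hf k).lintegral_prod_right'.aemeasurable]
  refine tsum_congr fun k => ?_
  exact lintegral_lintegral_swap ((hf k).comp measurable_swap).aemeasurable

namespace Network.IsModel

variable {Ω : Type*} [MeasurableSpace Ω] {P : Measure Ω} {N : ℕ}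
  {net : Network Ω N} {lam R : ℝ}

/-- The sum over all links of the averaged Frullani integrand: the fading is averaged out, then
the transmitters by Mecke's formula, then the link vectors in polar coordinates. -/
lemma tsum_lintegral_laplaceKernel [IsProbabilityMeasure P] (hnet : net.IsModel P lam R)
    (hlam : 0 < lam) (hN : 1 ≤ N) {α : ℝ} (hα : 2 < α) (hR : 1 < R) {t : ℝ} (ht : 0 < t)
    {A : Set Plane} (hA : MeasurableSet A) (hA' : volume A ≠ ∞) :
    ∑' k, ∫⁻ ω, A.indicator (fun _ => 1) (net.tx k ω) * net.laplaceKernel α k t ω ∂P =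
      ENNReal.ofReal lam * volume A *
        ENNReal.ofReal (Real.exp (-(lam * Real.pi / nsinc (2 / α) * t ^ (2 / α)))) *
        ∫⁻ r in Set.Ioc 1 R, ENNReal.ofReal (2 * r / (R ^ 2 - 1)) *
          (1 - (1 + ENNReal.ofReal (t * r ^ (-α)))⁻¹ ^ N) := by
  have hFc := continuous_interfererExponent α t
  have hFm := hFc.measurable
  let B : ℝ → ℝ≥0∞ := fun r => 1 - (1 + ENNReal.ofReal (t * r ^ (-α)))⁻¹ ^ N
  have hB : Measurable B := by fun_prop
  let G : ℕ → (ℕ → Plane) → Plane → ℝ≥0∞ := fun k x v => A.indicator (fun _ => 1) (x k) *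
    expNeg (∑' l, if l = k then 0 else interfererExponent α t ‖x k + v - x l‖)
  have hG : ∀ k, Measurable fun q : Plane × (ℕ → Plane) => G k q.2 q.1 := by
    intro k
    refine Measurable.mul ((measurable_const.indicator hA).comp
      ((measurable_pi_apply k).comp measurable_snd)) (measurable_expNeg.comp
      (Measurable.tsum fun l => ?_))
    split_ifs
    · exact measurable_const
    · exact hFm.comp (by fun_prop)
  have htx := hnet.measurable_tx_seq
  have hBG : ∀ k, Measurable fun q : Plane × (ℕ → Plane) => B ‖q.1‖ * G k q.2 q.1 := fun k =>
    (hB.comp measurable_fst.norm).mul (hG k)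
  have hGv : ∀ k v, Measurable fun ω => G k (fun j => net.tx j ω) v := fun k v =>
    (hG k).comp (measurable_const.prodMk htx)
  have hGi : ∀ k, Measurable fun v => ∫⁻ ω, G k (fun j => net.tx j ω) v ∂P := by
    intro k
    have h1 : Measurable fun q : Plane × Ω => G k (fun j => net.tx j q.2) q.1 :=
      (hG k).comp (measurable_fst.prodMk (htx.comp measurable_snd))
    exact h1.lintegral_prod_right'
  have hBGi : ∀ k, Measurable fun v => B ‖v‖ * ∫⁻ ω, G k (fun j => net.tx j ω) v ∂P := fun k =>
    (hB.comp measurable_norm).mul (hGi k)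
  have hmap : ∀ k, P.map (net.link k) = P.map (net.link 0) := fun k => by
    rw [hnet.uniform_link k, hnet.uniform_link 0]
  have hterm : ∀ k,
      ∫⁻ ω, A.indicator (fun _ => 1) (net.tx k ω) * net.laplaceKernel α k t ω ∂P =
        ∫⁻ v, B ‖v‖ * ∫⁻ ω, G k (fun j => net.tx j ω) v ∂P ∂(P.map (net.link 0)) := by
    intro k
    rw [hnet.lintegral_indicator_mul_laplaceKernel hN α k ht hA]
    -- off the null event `d = 0` the two conventions for `d ^ (-α)` agree
    have h1 : ∀ᵐ ω ∂P, ∀ l, net.tx k ω + net.link k ω - net.tx l ω ≠ 0 :=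
      ae_all_iff.2 fun l => hnet.ae_tx_add_link_sub_tx_ne_zero k l
    calc _ = ∫⁻ ω, B ‖net.link k ω‖ * G k (fun j => net.tx j ω) (net.link k ω) ∂P := by
          refine lintegral_congr_ae ?_
          filter_upwards [h1] with ω hω
          simp only [B, G]
          congr 4
          ext l
          split_ifs
          · rfl
          · rw [interfererExponent_of_pos α ht.le (norm_pos_iff.2 (hω l))]
      _ = ∫⁻ ω, ∫⁻ ω', B ‖net.link k ω‖ * G k (fun j => net.tx j ω') (net.link k ω) ∂P ∂P :=
          (hnet.indepFun_link_tx k).lintegral_comp_prodMk (hnet.measurable_link k) htx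
            (f := fun v x => B ‖v‖ * G k x v) (hBG k)
      _ = ∫⁻ ω, B ‖net.link k ω‖ * ∫⁻ ω', G k (fun j => net.tx j ω') (net.link k ω) ∂P ∂P :=
          lintegral_congr fun ω => lintegral_const_mul _ (hGv k _)
      _ = _ := by
          rw [← hmap k, lintegral_map (hBGi k) (hnet.measurable_link k)]
  simp_rw [hterm]
  rw [← lintegral_tsum fun k => (hBGi k).aemeasurable]
  have hmecke : ∀ v, ∑' k, ∫⁻ ω, G k (fun j => net.tx j ω) v ∂P = ENNReal.ofReal lam * volume A *
      ENNReal.ofReal (Real.exp (-(lam * Real.pi / nsinc (2 / α) * t ^ (2 / α)))) := by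
    intro v
    have hs := nsinc_pos hα
    have hpi := Real.pi_pos
    rw [← lintegral_tsum fun k => (hGv k v).aemeasurable]
    refine (hnet.ppp.mecke_radial (antitone_interfererExponent (by linarith) t) hFc
      (fun d hd => interfererExponent_ne_top α t hd) v hA hA').trans ?_
    simp_rw [expNeg_interfererExponent]
    rw [lintegral_plane_one_sub_inv hα ht, ← ENNReal.ofReal_mul hlam.le,
      expNeg_ofReal (by positivity)]
    congr 4
    ring
  simp_rw [ENNReal.tsum_mul_left, hmecke]
  have hBn : Measurable fun v : Plane => B ‖v‖ := hB.comp measurable_norm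
  rw [lintegral_mul_const _ hBn, hnet.lintegral_map_link hR hB 0, mul_comm]

lemma measurable_indicator_mul_laplaceKernel (hnet : net.IsModel P lam R) (α : ℝ) {A : Set Plane}
    (hA : MeasurableSet A) (k : ℕ) : Measurable fun p : ℝ × Ω =>
      A.indicator (fun _ => (1 : ℝ≥0∞)) (net.tx k p.2) * net.laplaceKernel α k p.1 p.2 := by
  have ha : Measurable fun ω => A.indicator (fun _ => (1 : ℝ≥0∞)) (net.tx k ω) :=
    (measurable_const.indicator hA).comp (hnet.ppp.measurable k)
  exact (ha.comp measurable_snd).mul (measurable_laplaceKernel hnet.ppp.measurable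
    hnet.measurable_link hnet.measurable_fading α k)

/-- Frullani's formula for the logarithm, summed over the links and averaged. -/
lemma lintegral_tsum_indicator_rate_eq_lintegral [IsProbabilityMeasure P]
    (hnet : net.IsModel P lam R) (α : ℝ) {SNR : ℝ} (hSNR : 0 < SNR) {A : Set Plane}
    (hA : MeasurableSet A) :
    ∫⁻ ω, ∑' k, A.indicator (fun _ => net.rate α SNR k ω) (net.tx k ω) ∂P =
      ENNReal.ofReal (1 / Real.log 2) * ∫⁻ t in Set.Ioi 0,
        (ENNReal.ofReal t)⁻¹ * expNeg (ENNReal.ofReal t * ENNReal.ofReal (1 / SNR)) *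
          ∑' k, ∫⁻ ω, A.indicator (fun _ => 1) (net.tx k ω) * net.laplaceKernel α k t ω ∂P := by
  have hK := hnet.measurable_indicator_mul_laplaceKernel α hA
  obtain ⟨E, hE, hEm⟩ : ∃ E : ℝ → ℝ≥0∞, (∀ t, E t = (ENNReal.ofReal t)⁻¹ *
      expNeg (ENNReal.ofReal t * ENNReal.ofReal (1 / SNR))) ∧ Measurable E :=
    ⟨_, fun t => rfl, by fun_prop⟩
  obtain ⟨K, hKe, hKm⟩ : ∃ K : ℕ → ℝ → Ω → ℝ≥0∞, (∀ k t ω, K k t ω =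
      A.indicator (fun _ => 1) (net.tx k ω) * net.laplaceKernel α k t ω) ∧
      ∀ k, Measurable fun p : ℝ × Ω => K k p.1 p.2 := ⟨_, fun k t ω => rfl, hK⟩
  have hEK : ∀ k, Measurable fun p : ℝ × Ω => E p.1 * K k p.1 p.2 := fun k =>
    (hEm.comp measurable_fst).mul (hKm k)
  have hrate : ∀ ω, ∑' k, A.indicator (fun _ => net.rate α SNR k ω) (net.tx k ω) =
      ENNReal.ofReal (1 / Real.log 2) * ∑' k, ∫⁻ t in Set.Ioi 0, E t * K k t ω := by
    intro ω
    rw [← ENNReal.tsum_mul_left]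
    refine tsum_congr fun k => ?_
    by_cases hk : net.tx k ω ∈ A
    · simp only [hk, Set.indicator_of_mem, hKe, one_mul, hE, mul_assoc]
      exact net.rate_eq_lintegral hSNR k ω
    · simp [hk, hKe]
  have hm : Measurable fun ω => ∑' k, ∫⁻ t in Set.Ioi 0, E t * K k t ω :=
    Measurable.tsum fun k => (hEK k).lintegral_prod_left'
  simp_rw [hrate]
  rw [lintegral_const_mul _ hm, lintegral_tsum_lintegral_comm (f := fun k t ω => E t * K k t ω) hEK]
  congr 1
  refine lintegral_congr fun t => ?_
  have hKt : ∀ k, Measurable fun ω => K k t ω := fun k => (hKm k).comp measurable_prodMk_left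
  simp_rw [← hE, ← hKe, lintegral_const_mul _ (hKt _)]
  rw [ENNReal.tsum_mul_left]

/-- The expected sum of the spectral efficiencies of the links in the window `A`. -/
lemma lintegral_tsum_indicator_rate [IsProbabilityMeasure P] (hnet : net.IsModel P lam R)
    (hlam : 0 < lam) (hN : 1 ≤ N) {α : ℝ} (hα : 2 < α) {SNR : ℝ} (hSNR : 0 < SNR) (hR : 1 < R)
    {A : Set Plane} (hA : MeasurableSet A) (hA' : volume A ≠ ∞) :
    ∫⁻ ω, ∑' k, A.indicator (fun _ => net.rate α SNR k ω) (net.tx k ω) ∂P =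
      ENNReal.ofReal (1 / Real.log 2) * (ENNReal.ofReal lam * volume A *
        ENNReal.ofReal (α / 2 * ∫ r in (1 : ℝ)..R,
          (∫ u in Set.Ioi 0, mrcIntegrand lam N α SNR r u) * (2 * r / (R ^ 2 - 1)))) := by
  have hσ : 0 < 1 / SNR := by positivity
  rw [hnet.lintegral_tsum_indicator_rate_eq_lintegral α hSNR hA]
  congr 1
  obtain ⟨b, hb, hbm⟩ : ∃ b : ℝ → ℝ → ℝ, (∀ r t, b r t = t⁻¹ * Real.exp (-(t * (1 / SNR))) *
        Real.exp (-(lam * Real.pi / nsinc (2 / α) * t ^ (2 / α))) *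
        (1 - (1 + t * r ^ (-α))⁻¹ ^ N)) ∧ Measurable fun q : ℝ × ℝ => b q.1 q.2 :=
    ⟨_, fun r t => rfl, by fun_prop⟩
  have hbr : ∀ r, Measurable fun t => b r t := fun r => hbm.comp measurable_prodMk_left
  have hgm : Measurable fun q : ℝ × ℝ =>
      ENNReal.ofReal (2 * q.2 / (R ^ 2 - 1)) * ENNReal.ofReal (b q.2 q.1) :=
    (by fun_prop : Measurable fun q : ℝ × ℝ => ENNReal.ofReal (2 * q.2 / (R ^ 2 - 1))).mul
      (hbm.comp measurable_swap).ennreal_ofReal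
  have ht : ∀ t ∈ Set.Ioi (0 : ℝ),
      (ENNReal.ofReal t)⁻¹ * expNeg (ENNReal.ofReal t * ENNReal.ofReal (1 / SNR)) *
        ∑' k, ∫⁻ ω, A.indicator (fun _ => 1) (net.tx k ω) * net.laplaceKernel α k t ω ∂P =
      ENNReal.ofReal lam * volume A * ∫⁻ r in Set.Ioc 1 R,
        ENNReal.ofReal (2 * r / (R ^ 2 - 1)) * ENNReal.ofReal (b r t) := by
    intro t (ht : 0 < t)
    rw [hnet.tsum_lintegral_laplaceKernel hlam hN hα hR ht hA hA',
      mul_assoc (ENNReal.ofReal lam * volume A), mul_left_comm]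
    congr 1
    rw [← mul_assoc, ← lintegral_const_mul _ (by fun_prop)]
    refine setLIntegral_congr_fun measurableSet_Ioc fun r hr => ?_
    have hr0 : 0 < r := by linarith [hr.1]
    rw [mul_left_comm, ← ENNReal.ofReal_mul ht.le, expNeg_ofReal (by positivity),
      ← ENNReal.ofReal_inv_of_pos ht, one_sub_inv_pow_eq_ofReal (by positivity),
      ← ENNReal.ofReal_mul (by positivity), ← ENNReal.ofReal_mul (by positivity),
      ← ENNReal.ofReal_mul (by positivity), hb]
  rw [setLIntegral_congr_fun measurableSet_Ioi ht, lintegral_const_mul _ hgm.lintegral_prod_right',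
    lintegral_lintegral_swap hgm.aemeasurable]
  congr 1
  rw [← lintegral_lintegral_laplace_eq hlam hα hSNR hR]
  refine lintegral_congr fun r => ?_
  simp_rw [← hb]
  exact lintegral_const_mul _ (hbr r).ennreal_ofReal

end Network.IsModel

theorem theorem1 {Ω : Type*} [MeasurableSpace Ω] (P : Measure Ω) [IsProbabilityMeasure P]
    (lam : ℝ) (hlam : 0 < lam) (N : ℕ) (hN : 1 ≤ N) (α : ℝ) (hα : 2 < α)
    (SNR : ℝ) (hSNR : 0 < SNR) (R : ℝ) (hR : 1 < R)
    (net : Network Ω N) (hnet : net.IsModel P lam R)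
    (A : Set Plane) (hA : MeasurableSet A) (hA0 : volume A ≠ 0) (hA1 : volume A ≠ ∞) :
    -- the integrals in the formula converge
    (∀ r ∈ Set.Icc 1 R, IntegrableOn (mrcIntegrand lam N α SNR r) (Set.Ioi 0)) ∧
    IntervalIntegrable
      (fun r => (∫ u in Set.Ioi 0, mrcIntegrand lam N α SNR r u) * (2 * r / (R ^ 2 - 1)))
      volume 1 R ∧
    -- the two expressions of the sum spectral efficiency agree
    net.sumSpectralEfficiency P α SNR A =
      ENNReal.ofReal lam * net.palmExpectation P lam A (net.rate α SNR) ∧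
    -- and are given by the formula
    net.sumSpectralEfficiency P α SNR A =
      ENNReal.ofReal (lam * (α / (2 * Real.log 2)) *
        ∫ r in (1 : ℝ)..R,
          (∫ u in Set.Ioi 0, mrcIntegrand lam N α SNR r u) * (2 * r / (R ^ 2 - 1))) := by
  refine ⟨fun r hr => integrableOn_mrcIntegrand hlam hα hSNR hr.1,
    intervalIntegrable_integral_mrcIntegrand hlam hα hSNR hR, ?_, ?_⟩
  · have hlam0 : ENNReal.ofReal lam ≠ 0 := by simpa using hlam
    rw [Network.sumSpectralEfficiency, Network.palmExpectation, ← mul_div_assoc,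
      ENNReal.mul_div_mul_left _ _ hlam0 ENNReal.ofReal_ne_top]
  · have hlog : 0 < Real.log 2 := Real.log_pos (by norm_num)
    rw [Network.sumSpectralEfficiency,
      hnet.lintegral_tsum_indicator_rate hlam hN hα hSNR hR hA hA1,
      mul_right_comm (ENNReal.ofReal lam), ← mul_assoc, ENNReal.mul_div_cancel_right hA0 hA1,
      ← ENNReal.ofReal_mul hlam.le, ← ENNReal.ofReal_mul (by positivity)]
    congr 1
    field_simp
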